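/- Let $m,n$ be positive integers. Write $R^{(k,l)}$ for the $k\times l$ matrices over $R$, $\sigma$ for the trace, and $\mathbb H=\{\tau=u+iv: v>0\}$. Let $\mathcal M$ be a positive definite symmetric real $m\times m$ matrix, and put $(x,y)_{\mathcal M}=\sigma({}^tx\mathcal M y)$, $\|x\|_{\mathcal M}^2=(x,x)_{\mathcal M}$ for $x,y\in\mathbb R^{(m,n)}$. **Setting.** Let $H$ be the Heisenberg group of triples $(\lambda,\mu;\kappa)$ with $\lambda,\mu\in\mathbb R^{(m,n)}$, $\kappa\in\mathbb R^{(m,m)}$ and $\kappa+\mu\,{}^t\lambda$ symmetric, with the law $(\lambda_0,\mu_0;\kappa_0)\circ(\lambda,\mu;\kappa)=(\lambda_0+\lambda,\mu_0+\mu;\kappa_0+\kappa+\lambda_0{}^t\mu-\mu_0{}^t\lambda)$. It acts on functions on $\mathbb R^{(m,n)}$ by $$[\mathscr W_{\mathcal M}(\lambda,\mu;\kappa)f](x)=e^{\pi i\,\sigma(\mathcal M(\kappa+\mu{}^t\lambda+2x{}^t\mu))}f(x+\lambda).$$ For $g=\begin{pmatrix}a&b\\c&d\end{pmatrix}\in SL(2,\mathbb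 R)$ and a Schwartz function $f$ on $\mathbb R^{(m,n)}$ let $$[R_{\mathcal M}(g)f](x)=\begin{cases}|a|^{mn/2}e^{\pi i ab\|x\|_{\mathcal M}^2}f(ax)&(c=0),\\ (\det\mathcal M)^{n/2}|c|^{-mn/2}\displaystyle\int_{\mathbb R^{(m,n)}}e^{\frac{\pi i}{c}(a\|x\|_{\mathcal M}^2+d\|y\|_{\mathcal M}^2-2(x,y)_{\mathcal M})}f(y)\,dy&(c\ne0).\end{cases}$$ For $\tau=u+iv\in\mathbb H$ and $\phi\in\mathbb R$ let $(\tau,\phi)$ denote the element $$\begin{pmatrix}1&u\\0&1\end{pmatrix}\begin{pmatrix}v^{1/2}&0\\0&v^{-1/2}\end{pmatrix}\begin{pmatrix}\cos\phi&-\sin\phi\\\sin\phi&\cos\phi\end{pmatrix}$$ of $SL(2,\mathbb R)$; it depends on $\phi$ only modulo $2\pi$. For a Schwartz function $f$ the theta sum is $$\Theta_f^{[\mathcal M]}(\tau,\phi;\lambda,\mu,\kappa)=\sum_{\omega\in\mathbb Z^{(m,n)}}\big[\mathscr W_{\mathcal M}(\lambda,\mu;\kappa)R_{\mathcal M}(\tau,\phi)f\big](\omega),$$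 and we also put $$\Theta_f^{[\mathcal M]}(\tau,\phi;\lambda,\mu)=v^{mn/4}\sum_{\omega\in\mathbb Z^{(m,n)}}e^{\pi i\{u\|\omega+\lambda\|_{\mathcal M}^2+2(\omega,\mu)_{\mathcal M}\}}[R_{\mathcal M}(i,\phi)f](v^{1/2}(\omega+\lambda)).$$ For $g_1,g_2\in SL(2,\mathbb R)$ let $c_{\mathcal M}(g_1,g_2)=e^{-\pi i\,mn\,\mathrm{sign}(c_1c_2c_3)/4}$, where $c_1,c_2,c_3$ are the lower left entries of $g_1,g_2,g_1g_2$ and $\mathrm{sign}(0)=0$. Let $S=\begin{pmatrix}0&-1\\1&0\end{pmatrix}$, and let $\arg$ be the principal argument, so $\arg\tau\in(0,\pi)$ for $\tau\in\mathbb H$. Let $G^{(m,n)}=SL(2,\mathbb R)\ltimes(\mathbb R^{(m,n)}\times\mathbb R^{(m,n)})$ with the law $(g_1,v_1)(g_2,v_2)=(g_1g_2,v_1g_2+v_2)$, where $(\lambda,\mu)\begin{pmatrix}a&b\\c&d\end{pmatrix}=(a\lambda+c\mu,b\lambda+d\mu)$. The element of $G^{(m,n)}$ with coordinates $(\tau,\phi;\lambda,\mu)$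 is the product $(I_2,(\lambda,\mu))\cdot((\tau,\phi),(0,0))$. Let $\Gamma^{(m,n)}_{[2]}$ be the subgroup of $G^{(m,n)}$ generated by $(S,(0,0))$, $\left(\begin{pmatrix}1&2\\0&1\end{pmatrix},(0,s)\right)$ and $(I_2,(\lambda_0,\mu_0))$ with $s,\lambda_0,\mu_0\in\mathbb Z^{(m,n)}$. **Theorem.** Let $\mathcal M$ be a positive definite symmetric integral $m\times m$ matrix, and let $f,g$ be Schwartz functions on $\mathbb R^{(m,n)}$. The series $\Theta_f^{[\mathcal M]}(\tau,\phi;\lambda,\mu,\kappa)$ converges absolutely, and for all $\tau\in\mathbb H$, $\phi\in\mathbb R$ and $(\lambda,\mu;\kappa)\in H$ the following hold. 1. (Jacobi 1) If $\mathcal M\,\mathbb Z^{(m,n)}=\mathbb Z^{(m,n)}$, then $$\Theta_f^{[\mathcal M]}\Big(-\frac1\tau,\phi+\arg\tau;-\mu,\lambda,\kappa\Big)=(\det\mathcal M)^{-n/2}\,c_{\mathcal M}(S,(\tau,\phi))\,\Theta_f^{[\mathcal M]}(\tau,\phi;\lambda,\mu,\kappa),$$ where $c_{\mathcal M}(S,(\tau,\phi))=e^{-\pi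 i\,mn\,\mathrm{sign}(\sin\phi\,\sin(\phi+\arg\tau))/4}$. 2. (Jacobi 2) For every $s\in\mathbb Z^{(m,n)}$, $$\Theta_f^{[\mathcal M]}(\tau+2,\phi;\lambda,s-2\lambda+\mu,\kappa-s\,{}^t\lambda)=\Theta_f^{[\mathcal M]}(\tau,\phi;\lambda,\mu,\kappa).$$ 3. (Jacobi 3) For every $(\lambda_0,\mu_0;\kappa_0)\in H$ with integral entries, $$\Theta_f^{[\mathcal M]}(\tau,\phi;\lambda+\lambda_0,\mu+\mu_0,\kappa+\kappa_0+\lambda_0{}^t\mu-\mu_0{}^t\lambda)=e^{\pi i\,\sigma(\mathcal M(\kappa_0+\mu_0{}^t\lambda_0))}\,\Theta_f^{[\mathcal M]}(\tau,\phi;\lambda,\mu,\kappa).$$ 4. If $\mathcal M\,\mathbb Z^{(m,n)}=\mathbb Z^{(m,n)}$ (so that $\mathcal M$ is unimodular), then the function $\Theta_f^{[\mathcal M]}(\tau,\phi;\lambda,\mu)\,\overline{\Theta_g^{[\mathcal M]}(\tau,\phi;\lambda,\mu)}$ on $G^{(m,n)}$ is invariant under left multiplication by $\Gamma^{(m,n)}_{[2]}$.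 -/

import Mathlib

open scoped Matrix SchwartzMap UpperHalfPlane

noncomputable section

namespace JacobiTheta

/-- Real `m × n` matrices. -/
abbrev RMat (m n : ℕ) := Matrix (Fin m) (Fin n) ℝ

/-- Integral `m × n` matrices. -/
abbrev ZMat (m n : ℕ) := Matrix (Fin m) (Fin n) ℤ

/-- An integral matrix regarded as a real matrix. -/
def toReal {m n : ℕ} (A : ZMat m n) : RMat m n := A.map (fun k : ℤ => (k : ℝ))

/-! ### The Heisenberg group -/

/-- The Heisenberg group: triples `(lam, mu; kap)` with `kap + mu * lamᵀ` symmetric. -/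
@[ext] structure Heis (m n : ℕ) where
  lam : RMat m n
  mu : RMat m n
  kap : RMat m m
  isSymm : (kap + mu * lamᵀ).IsSymm

variable {m n : ℕ}

theorem Heis.isSymm_mul (h k : Heis m n) :
    (h.kap + k.kap + h.lam * k.muᵀ - h.mu * k.lamᵀ +
      (h.mu + k.mu) * (h.lam + k.lam)ᵀ).IsSymm := by
  have h1 := h.isSymm
  have h2 := k.isSymm
  unfold Matrix.IsSymm at *
  simp only [Matrix.transpose_add, Matrix.transpose_sub, Matrix.transpose_mul,
    Matrix.transpose_transpose, Matrix.add_mul, Matrix.mul_add] at *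
  have e : h.kapᵀ = h.kap + h.mu * h.lamᵀ - h.lam * h.muᵀ := by rw [← h1]; abel
  have e' : k.kapᵀ = k.kap + k.mu * k.lamᵀ - k.lam * k.muᵀ := by rw [← h2]; abel
  rw [e, e']
  abel

/-- The multiplication law of the Heisenberg group. -/
instance : Mul (Heis m n) where
  mul h k := ⟨h.lam + k.lam, h.mu + k.mu,
    h.kap + k.kap + h.lam * k.muᵀ - h.mu * k.lamᵀ, h.isSymm_mul k⟩

/-- Elements all of whose entries are integers. -/
def Heis.IsIntegral (h : Heis m n) : Prop :=
  ∃ (l u : ZMat m n) (k : ZMat m m), h.lam = toReal l ∧ h.mu = toReal u ∧ h.kap = toReal k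

theorem Heis.isSymm_inversion (h : Heis m n) : (h.kap + h.lam * (-h.mu)ᵀ).IsSymm := by
  have h1 := h.isSymm
  unfold Matrix.IsSymm at *
  simp only [Matrix.transpose_add, Matrix.transpose_mul, Matrix.transpose_neg,
    Matrix.transpose_transpose, Matrix.mul_neg] at *
  have e : h.kapᵀ = h.kap + h.mu * h.lamᵀ - h.lam * h.muᵀ := by rw [← h1]; abel
  rw [e]
  abel

theorem Heis.isSymm_shift (h : Heis m n) (s : RMat m n) :
    (h.kap - s * h.lamᵀ + (s - (2 : ℝ) • h.lam + h.mu) * h.lamᵀ).IsSymm := by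
  have e : h.kap - s * h.lamᵀ + (s - (2 : ℝ) • h.lam + h.mu) * h.lamᵀ
      = (h.kap + h.mu * h.lamᵀ) - (2 : ℝ) • (h.lam * h.lamᵀ) := by
    simp only [Matrix.add_mul, Matrix.sub_mul, Matrix.smul_mul]
    abel
  rw [e]
  exact h.isSymm.sub (by
    unfold Matrix.IsSymm
    rw [Matrix.transpose_smul, Matrix.transpose_mul, Matrix.transpose_transpose])

/-! ### `SL(2, ℝ)` and its Iwasawa coordinates -/

/-- `SL(2, ℝ)`. -/
abbrev SL2R := Matrix.SpecialLinearGroup (Fin 2) ℝ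

/-- The matrix `(1 u; 0 1)`. -/
def unip (u : ℝ) : SL2R := ⟨!![1, u; 0, 1], by simp [Matrix.det_fin_two_of]⟩

/-- The matrix `(v^{1/2} 0; 0 v^{-1/2})`. -/
def diagEl (v : ℝ) (hv : 0 < v) : SL2R :=
  ⟨!![Real.sqrt v, 0; 0, (Real.sqrt v)⁻¹], by
    have : Real.sqrt v ≠ 0 := (Real.sqrt_pos.mpr hv).ne'
    simp [Matrix.det_fin_two_of, this]⟩

/-- The rotation `(cos φ, -sin φ; sin φ, cos φ)`. -/
def rot (φ : ℝ) : SL2R :=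
  ⟨!![Real.cos φ, -Real.sin φ; Real.sin φ, Real.cos φ], by
    rw [Matrix.det_fin_two_of]; nlinarith [Real.sin_sq_add_cos_sq φ]⟩

/-- The element `(τ, φ)` of `SL(2, ℝ)` with `τ = u + i v`. -/
def iwasawa (τ : ℍ) (φ : ℝ) : SL2R := unip τ.re * diagEl τ.im τ.im_pos * rot φ

/-- The matrix `S = (0 -1; 1 0)`. -/
def matS : SL2R := ⟨!![0, -1; 1, 0], by simp [Matrix.det_fin_two_of]⟩

theorem im_neg_one_div_pos (τ : ℍ) : 0 < (-1 / (τ : ℂ)).im := by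
  have h := τ.im_inv_neg_coe_pos
  rwa [show (-1 / (τ : ℂ)) = (-(τ : ℂ))⁻¹ by rw [inv_neg, neg_div, one_div]]

/-- The point `-1/τ` of the upper half plane. -/
def negInv (τ : ℍ) : ℍ := ⟨-1 / (τ : ℂ), im_neg_one_div_pos τ⟩

/-! ### The Schrödinger representation, the Weil representation and theta sums -/

/-- `(x, y)_M = tr(ᵗx M y)`. -/
def bil (M : RMat m m) (x y : RMat m n) : ℝ := (xᵀ * M * y).trace

/-- The Schrödinger representation of the Heisenberg group:
`[W(h₀) F](x) = exp(π i tr(M(κ₀ + μ₀ ᵗλ₀ + 2 x ᵗμ₀))) F(x + λ₀)`. -/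
def schrodinger (M : RMat m m) (h : Heis m n) (F : RMat m n → ℂ) (x : RMat m n) : ℂ :=
  Complex.exp (Real.pi * Complex.I *
    ((M * (h.kap + h.mu * h.lamᵀ + (2 : ℝ) • (x * h.muᵀ))).trace : ℝ)) * F (x + h.lam)

/-- The (projective) Weil representation of the matrix `(a b; c d)` of `SL(2, ℝ)`, embedded in
`Sp(n, ℝ)` as `(a I, b I; c I, d I)`, on functions on real `m × n` matrices. It is meant to be
applied to Schwartz functions, where the integral converges absolutely. -/
def weil (M : RMat m m) (g : SL2R) (F : RMat m n → ℂ) (x : RMat m n) : ℂ :=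
  let a := g.1 0 0
  let b := g.1 0 1
  let c := g.1 1 0
  let d := g.1 1 1
  if c = 0 then
    ((|a| ^ ((m * n : ℝ) / 2) : ℝ) : ℂ) *
      Complex.exp (Real.pi * Complex.I * (a * b * bil M x x : ℝ)) * F (a • x)
  else
    ((M.det ^ ((n : ℝ) / 2) * |c| ^ (-(m * n : ℝ) / 2) : ℝ) : ℂ) *
      ∫ y : Fin m → Fin n → ℝ,
        Complex.exp (Real.pi * Complex.I *
          ((a * bil M x x + d * bil M (Matrix.of y) (Matrix.of y)
            - 2 * bil M x (Matrix.of y)) / c : ℝ)) * F (Matrix.of y)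

/-- The projective representation `π(h g) = W(h) R(g)` of the Jacobi group. -/
def jacobiRep (M : RMat m m) (h : Heis m n) (g : SL2R) (F : RMat m n → ℂ) : RMat m n → ℂ :=
  schrodinger M h (weil M g F)

/-- A Schwartz function, regarded as a function of a matrix. -/
def onMat (f : 𝓢(Fin m → Fin n → ℝ, ℂ)) : RMat m n → ℂ := fun x => f (Matrix.of.symm x)

/-- The term of the theta sum indexed by the integral matrix `ω`. -/
def thetaTerm (M : RMat m m) (f : 𝓢(Fin m → Fin n → ℝ, ℂ)) (τ : ℍ) (φ : ℝ) (h : Heis m n)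
    (ω : ZMat m n) : ℂ :=
  jacobiRep M h (iwasawa τ φ) (onMat f) (toReal ω)

/-- The theta sum `Θ_f(τ, φ; λ, μ, κ)`, summed over all integral matrices. -/
def theta (M : RMat m m) (f : 𝓢(Fin m → Fin n → ℝ, ℂ)) (τ : ℍ) (φ : ℝ) (h : Heis m n) : ℂ :=
  ∑' ω : ZMat m n, thetaTerm M f τ φ h ω

/-- The cocycle `c(M₁, M₂) = exp(-π i m n sign(c₁ c₂ c₃) / 4)`, where `c₁, c₂, c₃` are the
lower left entries of `M₁`, `M₂` and `M₁ M₂`. -/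
def cocycle (m n : ℕ) (g₁ g₂ : SL2R) : ℂ :=
  Complex.exp (-(Complex.I * Real.pi * (m * n : ℝ) *
    (Real.sign (g₁.1 1 0 * g₂.1 1 0 * (g₁ * g₂).1 1 0) : ℝ) / 4))

/-- The theta sum `Θ_f(τ, φ; λ, μ)` without the central variable. -/
def thetaV (M : RMat m m) (f : 𝓢(Fin m → Fin n → ℝ, ℂ)) (τ : ℍ) (φ : ℝ)
    (lam mu : RMat m n) : ℂ :=
  ((τ.im ^ ((m * n : ℝ) / 4) : ℝ) : ℂ) *
    ∑' ω : ZMat m n,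
      Complex.exp (Real.pi * Complex.I *
        (τ.re * bil M (toReal ω + lam) (toReal ω + lam) + 2 * bil M (toReal ω) mu : ℝ)) *
      weil M (iwasawa UpperHalfPlane.I φ) (onMat f) (Real.sqrt τ.im • (toReal ω + lam))

/-! ### The group `SL(2, ℝ) ⋉ V(m, n)` -/

/-- `V(m, n)`, pairs of real `m × n` matrices. -/
abbrev VPair (m n : ℕ) := RMat m n × RMat m n

/-- The right action `(λ, μ) g = (a λ + c μ, b λ + d μ)` for `g = (a b; c d)`. -/
def rAct (p : VPair m n) (g : SL2R) : VPair m n :=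
  (g.1 0 0 • p.1 + g.1 1 0 • p.2, g.1 0 1 • p.1 + g.1 1 1 • p.2)

theorem rAct_one (p : VPair m n) : rAct p 1 = p := by
  simp [rAct]

theorem rAct_zero (g : SL2R) : rAct (0 : VPair m n) g = 0 := by
  simp [rAct]

theorem rAct_mul (p : VPair m n) (g k : SL2R) : rAct p (g * k) = rAct (rAct p g) k := by
  ext i j <;>
  · simp [rAct, Matrix.mul_apply, Fin.sum_univ_two]
    ring

theorem rAct_add (p q : VPair m n) (g : SL2R) : rAct (p + q) g = rAct p g + rAct q g := by
  ext i j <;>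
  · simp [rAct]
    ring

theorem rAct_neg (p : VPair m n) (g : SL2R) : rAct (-p) g = -rAct p g := by
  ext i j <;>
  · simp [rAct]
    ring

/-- The set underlying `SL(2, ℝ) ⋉ V(m, n)`. -/
@[ext] structure GV (m n : ℕ) where
  sl : SL2R
  vec : VPair m n

/-- The group law `(g₁, v₁)(g₂, v₂) = (g₁ g₂, v₁ g₂ + v₂)`. -/
instance : Mul (GV m n) where
  mul x y := ⟨x.sl * y.sl, rAct x.vec y.sl + y.vec⟩

instance : One (GV m n) where
  one := ⟨1, 0⟩

instance : Inv (GV m n) where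
  inv x := ⟨x.sl⁻¹, -rAct x.vec x.sl⁻¹⟩

theorem GV.mul_def (x y : GV m n) : x * y = ⟨x.sl * y.sl, rAct x.vec y.sl + y.vec⟩ := rfl

theorem GV.one_def : (1 : GV m n) = ⟨1, 0⟩ := rfl

theorem GV.inv_def (x : GV m n) : x⁻¹ = ⟨x.sl⁻¹, -rAct x.vec x.sl⁻¹⟩ := rfl

instance : Group (GV m n) :=
  Group.ofLeftAxioms
    (fun x y z => by
      simp only [GV.mul_def, mul_assoc, rAct_mul, rAct_add, add_assoc])
    (fun x => by simp [GV.mul_def, GV.one_def, rAct_zero])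
    (fun x => by
      simp [GV.mul_def, GV.one_def, GV.inv_def, rAct_neg, ← rAct_mul, rAct_one])

/-- The element of `SL(2, ℝ) ⋉ V(m, n)` with coordinates `(τ, φ; λ, μ)`: as in the
decomposition `h g` of the elements of the Jacobi group, it is the product
`(1, (λ, μ)) ((τ, φ), 0) = ((τ, φ), (λ, μ) (τ, φ))`. -/
def ofCoord (τ : ℍ) (φ : ℝ) (lam mu : RMat m n) : GV m n :=
  (⟨1, (lam, mu)⟩ : GV m n) * ⟨iwasawa τ φ, 0⟩

/-- The subgroup generated by `(S, (0, 0))`, `((1 2; 0 1), (0, s))` and `(1, (λ₀, μ₀))` with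
`s, λ₀, μ₀` integral. -/
def Gamma2 (m n : ℕ) : Subgroup (GV m n) :=
  Subgroup.closure
    ({⟨matS, 0⟩} ∪ {x | ∃ s : ZMat m n, x = ⟨unip 2, (0, toReal s)⟩} ∪
      {x | ∃ l u : ZMat m n, x = ⟨1, (toReal l, toReal u)⟩})

end JacobiTheta

end

open JacobiTheta

/-!
On Schwartz functions the Weil representation is generated by quadratic chirps, dilations and the
Fourier transform: after the substitution `x ↦ A x` with `M = ᵗA A` it lives on a Euclidean space.
Its cocycle comes from the Fourier transform of a chirp, which is the boundary value on the
imaginary axis of the Fourier transform of a Gaussian. The theta sum is the value of the functional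
`F ↦ ∑ F ω` on `W(h) R(g) f`. Poisson summation and the unimodularity of `M` make this functional
invariant under `R(S)`. It is invariant under `W(h₀)`, up to the phase of `h₀`, for integral `h₀`,
because `2 (ω, μ₀)` is an even integer. Under `τ ↦ τ + 2` the chirp `exp (2 π i ‖ω + λ‖²)` is
absorbed by the shift of `μ` and `κ`, because `‖ω‖²` and `(s, ω)` are integers. The cocycle and the
phases have absolute value `1`, so they cancel in `Θ_f ⋅ conj Θ_g`.
-/

namespace JacobiTheta

open MeasureTheory Module
open scoped Real FourierTransform RealInnerProductSpace

/-! ### Poisson summation -/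

section Poisson

variable {ι : Type*}

/-- An integral vector regarded as a real vector. -/
def intVec (k : ι → ℤ) : ι → ℝ := fun i => (k i : ℝ)

/-- The half-open unit cube whose lower corner is the integral vector `k`. -/
def unitCube (k : ι → ℤ) : Set (ι → ℝ) := Set.univ.pi fun i => Set.Ioc (k i : ℝ) (k i + 1)

/-- The projection of `ℝ^ι` onto the torus `(ℝ/ℤ)^ι`. -/
def torusMk : C(ι → ℝ, UnitAddTorus ι) where
  toFun x i := (x i : UnitAddCircle)
  continuous_toFun := continuous_pi fun i =>
    continuous_quotient_mk'.comp (continuous_apply i)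

theorem isQuotientMap_torusMk : Topology.IsQuotientMap (torusMk : C(ι → ℝ, UnitAddTorus ι)) :=
  (IsOpenQuotientMap.piMap fun _ => QuotientAddGroup.isOpenQuotientMap_mk).isQuotientMap

theorem torusMk_add_intVec (x : ι → ℝ) (k : ι → ℤ) : torusMk (x + intVec k) = torusMk x := by
  ext i
  simp [torusMk, intVec]

theorem exists_eq_add_intVec {x y : ι → ℝ} (h : torusMk x = torusMk y) :
    ∃ l : ι → ℤ, x = y + intVec l := by
  have h_coord (i : ι) : ∃ l : ℤ, x i = y i + l := by
    have h_sub : ((x i - y i : ℝ) : UnitAddCircle) = 0 := by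
      rw [AddCircle.coe_sub, sub_eq_zero]
      exact congrFun h i
    obtain ⟨l, hl⟩ := (AddCircle.coe_eq_zero_iff (1 : ℝ)).mp h_sub
    exact ⟨l, by rw [← zsmul_one, hl]; ring⟩
  choose l hl using h_coord
  exact ⟨l, funext hl⟩

theorem tsum_comp_addRight_add_intVec (f : C(ι → ℝ, ℂ)) (x : ι → ℝ) (l : ι → ℤ) :
    (∑' k : ι → ℤ, f.comp (.addRight (intVec k))) (x + intVec l) =
      (∑' k : ι → ℤ, f.comp (.addRight (intVec k))) x := by
  by_cases h : Summable fun k : ι → ℤ => f.comp (.addRight (intVec k))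
  · rw [← ContinuousMap.tsum_apply h, ← ContinuousMap.tsum_apply h,
      ← (Equiv.addLeft l).tsum_eq fun k => f.comp (.addRight (intVec k)) x]
    refine tsum_congr fun k => congrArg f ?_
    ext i
    simp [intVec, add_assoc]
  · simp [tsum_eq_zero_of_not_summable h]

/-- The periodization `x ↦ ∑ₖ f (x + k)` of a continuous function on `ℝ^ι`, as a function on the
torus; it is `0` when the series does not converge locally uniformly. -/
noncomputable def periodize (f : C(ι → ℝ, ℂ)) : C(UnitAddTorus ι, ℂ) :=
  isQuotientMap_torusMk.lift (∑' k : ι → ℤ, f.comp (.addRight (intVec k))) fun x y h => by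
    obtain ⟨l, rfl⟩ := exists_eq_add_intVec h
    exact tsum_comp_addRight_add_intVec f y l

theorem periodize_comp_torusMk (f : C(ι → ℝ, ℂ)) :
    (periodize f).comp torusMk = ∑' k : ι → ℤ, f.comp (.addRight (intVec k)) :=
  isQuotientMap_torusMk.lift_comp _ _

theorem periodize_torusMk {f : C(ι → ℝ, ℂ)}
    (hf : Summable fun k : ι → ℤ => f.comp (.addRight (intVec k))) (x : ι → ℝ) :
    periodize f (torusMk x) = ∑' k : ι → ℤ, f (x + intVec k) :=
  (DFunLike.congr_fun (periodize_comp_torusMk f) x).trans (ContinuousMap.tsum_apply hf x).symm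

theorem iUnion_unitCube : ⋃ k : ι → ℤ, unitCube k = Set.univ := by
  simp only [unitCube, Set.iUnion_univ_pi (fun _ (j : ℤ) => Set.Ioc (j : ℝ) (j + 1)),
    iUnion_Ioc_intCast, Set.pi_univ]

theorem pairwise_disjoint_unitCube :
    Pairwise (Function.onFun Disjoint (unitCube : (ι → ℤ) → Set (ι → ℝ))) := by
  intro k l hkl
  obtain ⟨i, hi⟩ := Function.ne_iff.mp hkl
  exact Set.disjoint_univ_pi.mpr ⟨i, Set.pairwise_disjoint_Ioc_intCast ℝ hi⟩

theorem measurableSet_unitCube [Countable ι] (k : ι → ℤ) : MeasurableSet (unitCube k) :=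
  MeasurableSet.univ_pi fun _ => measurableSet_Ioc

variable [Fintype ι]

theorem hasSum_integral_unitCube {E : Type*} [NormedAddCommGroup E] [NormedSpace ℝ E]
    {f : (ι → ℝ) → E} (hf : Integrable f) :
    HasSum (fun k : ι → ℤ => ∫ x in unitCube 0, f (x + intVec k)) (∫ x, f x) := by
  have h_translate (k : ι → ℤ) :
      ∫ x in unitCube 0, f (x + intVec k) = ∫ x in unitCube k, f x := by
    rw [← (measurePreserving_add_right volume (intVec k)).setIntegral_preimage_emb
      (measurableEmbedding_addRight _) f (unitCube k)]
    congr 2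
    ext x
    simp [unitCube, intVec, add_comm (x _)]
  simpa only [h_translate, iUnion_unitCube, Measure.restrict_univ] using
    hasSum_integral_iUnion measurableSet_unitCube pairwise_disjoint_unitCube hf.integrableOn

theorem integral_unitCube_tsum {f : (ι → ℝ) → ℂ} (hf : Integrable f) :
    ∫ x in unitCube (0 : ι → ℤ), ∑' k : ι → ℤ, f (x + intVec k) = ∫ x, f x :=
  (hasSum_integral_of_summable_integral_norm
    (fun k => (hf.comp_add_right (intVec k)).integrableOn)
    (hasSum_integral_unitCube hf.norm).summable).unique (hasSum_integral_unitCube hf)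

theorem mFourier_torusMk (k : ι → ℤ) (x : ι → ℝ) :
    UnitAddTorus.mFourier k (torusMk x) =
      Complex.exp (2 * π * Complex.I * (∑ i, (k i : ℝ) * x i : ℝ)) := by
  simp only [UnitAddTorus.mFourier, ContinuousMap.coe_mk, torusMk, fourier_coe_apply,
    ← Complex.exp_sum]
  push_cast
  rw [Finset.mul_sum]
  exact congrArg _ (Finset.sum_congr rfl fun i _ => by ring)

theorem integrable_mFourier_mul (k : ι → ℤ) {f : (ι → ℝ) → ℂ} (hf : Integrable f) :
    Integrable fun x => UnitAddTorus.mFourier k (torusMk x) * f x := by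
  refine hf.bdd_mul (c := 1) (by fun_prop) (ae_of_all _ fun x => ?_)
  rw [mFourier_torusMk, mul_assoc, mul_comm Complex.I, ← mul_assoc]
  exact_mod_cast (Complex.norm_exp_ofReal_mul_I _).le

theorem mFourierCoeff_periodize {f : C(ι → ℝ, ℂ)}
    (hf : Summable fun k : ι → ℤ => f.comp (.addRight (intVec k))) (hint : Integrable f)
    (k : ι → ℤ) :
    UnitAddTorus.mFourierCoeff (periodize f) k =
      ∫ x, UnitAddTorus.mFourier (-k) (torusMk x) * f x := by
  rw [← integral_unitCube_tsum (integrable_mFourier_mul (-k) hint),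
    UnitAddTorus.mFourierCoeff_eq_integral _ _ 0]
  have h_cube : {x : ι → ℝ | ∀ i, x i ∈ Set.Ioc ((0 : ι → ℝ) i) ((0 : ι → ℝ) i + 1)} =
      unitCube 0 := by
    ext x
    simp [unitCube]
  rw [h_cube]
  refine integral_congr_ae (ae_of_all _ fun x => ?_)
  simp only [torusMk_add_intVec, tsum_mul_left, ← periodize_torusMk hf, smul_eq_mul]
  rfl

theorem tsum_intVec_eq_tsum_integral {f : C(ι → ℝ, ℂ)}
    (hf : Summable fun k : ι → ℤ => f.comp (.addRight (intVec k))) (hint : Integrable f)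
    (hsum : Summable fun k : ι → ℤ => ∫ x, UnitAddTorus.mFourier (-k) (torusMk x) * f x) :
    ∑' k : ι → ℤ, f (intVec k) =
      ∑' k : ι → ℤ, ∫ x, UnitAddTorus.mFourier (-k) (torusMk x) * f x := by
  simp only [← mFourierCoeff_periodize hf hint] at hsum ⊢
  have h_series := UnitAddTorus.hasSum_mFourier_series_apply_of_summable hsum (torusMk 0)
  simpa [periodize_torusMk hf, mFourier_torusMk] using h_series.tsum_eq.symm

end Poisson

section PoissonSchwartz

variable {ι : Type*} [Fintype ι]

/-- The points of the standard lattice in a Euclidean space. -/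
abbrev intPoint (k : ι → ℤ) : EuclideanSpace ℝ ι := WithLp.toLp 2 (intVec k)

theorem summable_inv_norm_intPoint_pow {N : ℕ} (hN : Fintype.card ι < N) :
    Summable fun k : ι → ℤ => ‖intPoint k‖⁻¹ ^ N := by
  classical
  let b := (EuclideanSpace.basisFun ι ℝ).toBasis
  let e := (b.restrictScalars ℤ).equivFun.symm
  have h_rank : finrank ℤ (Submodule.span ℤ (Set.range b)) < N := by
    rwa [finrank_eq_card_basis (b.restrictScalars ℤ)]
  have h_coe (k : ι → ℤ) : ((e k : Submodule.span ℤ (Set.range b)) : EuclideanSpace ℝ ι) =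
      intPoint k := by
    ext i
    have h_repr : (b.restrictScalars ℤ).repr (e k) i = k i :=
      congrFun ((b.restrictScalars ℤ).equivFun.apply_symm_apply k) i
    have := b.restrictScalars_repr_apply ℤ (e k) i
    rw [h_repr] at this
    simpa [b, intVec] using this.symm
  have := (ZLattice.summable_norm_pow_inv _ N h_rank).comp_injective e.injective
  exact this.congr fun k => by simp only [Function.comp_apply, Submodule.coe_norm, h_coe]

theorem summable_inv_one_add_norm_intPoint_pow {N : ℕ} (hN : Fintype.card ι < N) :
    Summable fun k : ι → ℤ => (1 + ‖intPoint k‖)⁻¹ ^ N := by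
  refine (summable_inv_norm_intPoint_pow hN).of_norm_bounded_eventually ?_
  filter_upwards [(Set.finite_singleton (0 : ι → ℤ)).compl_mem_cofinite] with k hk
  have h_pos : 0 < ‖intPoint k‖ := by
    refine norm_pos_iff.mpr fun h => hk (funext fun i => ?_)
    simpa [intVec] using congrArg (fun v => v i) h
  rw [Real.norm_of_nonneg (by positivity)]
  gcongr
  linarith

/-- Peetre's inequality `1 + ‖y‖ ≤ (1 + ‖x‖) (1 + ‖x + y‖)` turns the decay of `f` into a bound
that is locally uniform in the translation `x`. -/
theorem exists_norm_schwartz_add_le {E : Type*} [NormedAddCommGroup E] [NormedSpace ℝ E]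
    (f : 𝓢(E, ℂ)) (N : ℕ) :
    ∃ C, ∀ x y, ‖f (x + y)‖ ≤ C * (1 + ‖x‖) ^ N * (1 + ‖y‖)⁻¹ ^ N := by
  obtain ⟨C, h_decay⟩ : ∃ C, ∀ z, (1 + ‖z‖) ^ N * ‖f z‖ ≤ C :=
    ⟨_, fun z => by simpa only [norm_iteratedFDeriv_zero] using
      f.one_add_le_sup_seminorm_apply (𝕜 := ℝ) (m := (N, 0)) le_rfl le_rfl z⟩
  refine ⟨C, fun x y => ?_⟩
  have h_peetre : 1 + ‖y‖ ≤ (1 + ‖x‖) * (1 + ‖x + y‖) := by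
    have : ‖y‖ ≤ ‖x + y‖ + ‖x‖ := by simpa using norm_sub_le (x + y) x
    nlinarith [norm_nonneg x, norm_nonneg (x + y)]
  rw [inv_pow, ← div_eq_mul_inv, le_div_iff₀ (by positivity)]
  calc ‖f (x + y)‖ * (1 + ‖y‖) ^ N ≤ ‖f (x + y)‖ * ((1 + ‖x‖) * (1 + ‖x + y‖)) ^ N := by gcongr
    _ = (1 + ‖x + y‖) ^ N * ‖f (x + y)‖ * (1 + ‖x‖) ^ N := by rw [mul_pow]; ring
    _ ≤ C * (1 + ‖x‖) ^ N := by gcongr; exact h_decay _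

theorem summable_schwartz_intPoint (f : 𝓢(EuclideanSpace ℝ ι, ℂ)) :
    Summable fun k : ι → ℤ => f (intPoint k) := by
  obtain ⟨C, hC⟩ := exists_norm_schwartz_add_le f (Fintype.card ι + 1)
  refine .of_norm_bounded
    ((summable_inv_one_add_norm_intPoint_pow (Nat.lt_succ_self _)).mul_left C) fun k => ?_
  simpa using hC 0 (intPoint k)

theorem summable_schwartz_comp_addRight (f : 𝓢(EuclideanSpace ℝ ι, ℂ))
    (g : C(ι → ℝ, ℂ)) (hg : ∀ x, g x = f (WithLp.toLp 2 x)) :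
    Summable fun k : ι → ℤ => g.comp (.addRight (intVec k)) := by
  obtain ⟨C, hC⟩ := exists_norm_schwartz_add_le f (Fintype.card ι + 1)
  refine ContinuousMap.summable_of_locally_summable_norm fun K => ?_
  obtain ⟨R, hR⟩ := (K.isCompact.image (PiLp.continuous_toLp 2 _)).isBounded.exists_norm_le
  refine .of_norm_bounded ((summable_inv_one_add_norm_intPoint_pow (Nat.lt_succ_self _)).mul_left
    (|C| * (1 + |R|) ^ (Fintype.card ι + 1))) fun k => ?_
  rw [norm_norm, ContinuousMap.norm_le _ (by positivity)]
  intro x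
  have h_bound := hC (WithLp.toLp 2 x) (intPoint k)
  rw [← WithLp.toLp_add, ← hg] at h_bound
  refine h_bound.trans ?_
  gcongr
  · exact le_abs_self C
  · exact (hR _ ⟨x, x.2, rfl⟩).trans (le_abs_self R)

theorem tsum_schwartz_intPoint_eq_tsum_fourier (f : 𝓢(EuclideanSpace ℝ ι, ℂ)) :
    ∑' k : ι → ℤ, f (intPoint k) = ∑' k : ι → ℤ, 𝓕 f (intPoint k) := by
  let g : C(ι → ℝ, ℂ) := (⟨f, f.continuous⟩ : C(_, ℂ)).comp ⟨_, PiLp.continuous_toLp 2 _⟩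
  have h_fourier (k : ι → ℤ) :
      ∫ x, UnitAddTorus.mFourier (-k) (torusMk x) * g x = 𝓕 f (intPoint k) := by
    rw [SchwartzMap.fourier_coe, Real.fourier_eq',
      ← (PiLp.volume_preserving_toLp ι).integral_comp
        (MeasurableEquiv.toLp 2 (ι → ℝ)).measurableEmbedding]
    refine integral_congr_ae (ae_of_all _ fun x => ?_)
    have h_inner : ⟪WithLp.toLp 2 x, intPoint k⟫ = ∑ i, (k i : ℝ) * x i := by
      simp [PiLp.inner_apply, intVec]
    simp only [mFourier_torusMk, h_inner, Pi.neg_apply, smul_eq_mul]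
    refine congrArg (Complex.exp · * f (WithLp.toLp 2 x)) ?_
    push_cast
    simp only [neg_mul, Finset.sum_neg_distrib]
    ring
  have := tsum_intVec_eq_tsum_integral (f := g) (summable_schwartz_comp_addRight f g fun _ => rfl)
    ((PiLp.volume_preserving_toLp ι).integrable_comp_of_integrable f.integrable)
    (by simpa only [h_fourier] using summable_schwartz_intPoint (𝓕 f))
  simp only [h_fourier] at this
  exact this

end PoissonSchwartz

/-! ### The Weil representation on a Euclidean space -/

/-- The additive character `t ↦ exp (π i t)` of `ℝ`, which has period `2`. -/
noncomputable def expPi (t : ℝ) : ℂ := Complex.exp (π * Complex.I * t)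

@[simp]
theorem expPi_zero : expPi 0 = 1 := by simp [expPi]

theorem expPi_add (s t : ℝ) : expPi (s + t) = expPi s * expPi t := by
  simp only [expPi, Complex.ofReal_add, mul_add, Complex.exp_add]

theorem norm_expPi (t : ℝ) : ‖expPi t‖ = 1 := by
  simp [expPi, Complex.norm_exp]

theorem expPi_two_mul_intCast (k : ℤ) : expPi (2 * k) = 1 := by
  rw [expPi, Complex.exp_eq_one_iff]
  exact ⟨k, by push_cast; ring⟩

theorem hasDerivAt_expPi (t : ℝ) : HasDerivAt expPi (π * Complex.I * expPi t) t := by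
  have h : HasDerivAt (fun s : ℝ => π * Complex.I * (s : ℂ)) (π * Complex.I) t := by
    simpa using (hasDerivAt_id t).ofReal_comp.const_mul (π * Complex.I)
  exact h.cexp.congr_deriv (mul_comm _ _)

theorem iteratedDeriv_expPi (k : ℕ) :
    iteratedDeriv k expPi = fun t => (π * Complex.I) ^ k * expPi t := by
  induction k with
  | zero => simp
  | succ k ih =>
    funext t
    rw [iteratedDeriv_succ, ih, ((hasDerivAt_expPi t).const_mul _).deriv]
    ring

theorem hasTemperateGrowth_expPi : Function.HasTemperateGrowth expPi := by
  refine ⟨?_, fun k => ⟨0, π ^ k, fun t => ?_⟩⟩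
  · exact (contDiff_const.mul Complex.ofRealCLM.contDiff).cexp
  · rw [norm_iteratedFDeriv_eq_norm_iteratedDeriv, iteratedDeriv_expPi]
    simp [norm_expPi, abs_of_pos Real.pi_pos]

section Operators

variable {V : Type*} [NormedAddCommGroup V] [InnerProductSpace ℝ V]

/-- Multiplication of a Schwartz function by the quadratic chirp `x ↦ exp (π i t ‖x‖²)`. -/
noncomputable def chirp (t : ℝ) : 𝓢(V, ℂ) →L[ℂ] 𝓢(V, ℂ) :=
  SchwartzMap.smulLeftCLM ℂ fun x : V => expPi (t * ‖x‖ ^ 2)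

/-- The dilation `f ↦ f (a • ·)` of Schwartz functions, with the junk value `0` for `a = 0`. -/
noncomputable def dilation (a : ℝ) : 𝓢(V, ℂ) →L[ℂ] 𝓢(V, ℂ) :=
  if ha : a = 0 then 0 else
    SchwartzMap.compCLMOfContinuousLinearEquiv ℂ (.smulLeft (Units.mk0 a ha))

theorem chirp_apply (t : ℝ) (f : 𝓢(V, ℂ)) (x : V) : chirp t f x = expPi (t * ‖x‖ ^ 2) * f x := by
  have h_growth : Function.HasTemperateGrowth fun x : V => expPi (t * ‖x‖ ^ 2) :=
    hasTemperateGrowth_expPi.comp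
      ((Function.HasTemperateGrowth.const t).mul (Function.hasTemperateGrowth_norm_sq V))
  rw [chirp, SchwartzMap.smulLeftCLM_apply_apply h_growth, smul_eq_mul]

theorem dilation_apply {a : ℝ} (ha : a ≠ 0) (f : 𝓢(V, ℂ)) (x : V) :
    dilation a f x = f (a • x) := by
  simp [dilation, ha, Units.smul_def]

theorem chirp_zero (f : 𝓢(V, ℂ)) : chirp 0 f = f := by
  ext x
  simp [chirp_apply]

theorem chirp_chirp (s t : ℝ) (f : 𝓢(V, ℂ)) : chirp s (chirp t f) = chirp (s + t) f := by
  ext x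
  simp only [chirp_apply, ← mul_assoc, ← expPi_add, add_mul]

theorem dilation_one (f : 𝓢(V, ℂ)) : dilation 1 f = f := by
  ext x
  simp [dilation_apply]

theorem dilation_dilation {a b : ℝ} (ha : a ≠ 0) (hb : b ≠ 0) (f : 𝓢(V, ℂ)) :
    dilation a (dilation b f) = dilation (a * b) f := by
  ext x
  rw [dilation_apply ha, dilation_apply hb, dilation_apply (mul_ne_zero ha hb), smul_smul,
    mul_comm]

theorem dilation_chirp {a : ℝ} (ha : a ≠ 0) (t : ℝ) (f : 𝓢(V, ℂ)) :
    dilation a (chirp t f) = chirp (a ^ 2 * t) (dilation a f) := by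
  ext x
  simp only [dilation_apply ha, chirp_apply, norm_smul, mul_pow, Real.norm_eq_abs, sq_abs]
  ring_nf

variable [FiniteDimensional ℝ V] [MeasurableSpace V] [BorelSpace V]

theorem fourier_apply_eq_integral_expPi (f : 𝓢(V, ℂ)) (x : V) :
    𝓕 f x = ∫ y, expPi (-2 * ⟪y, x⟫) * f y := by
  rw [SchwartzMap.fourier_coe, Real.fourier_eq']
  refine integral_congr_ae (ae_of_all _ fun y => ?_)
  simp only [expPi, smul_eq_mul]
  push_cast
  ring_nf

theorem fourier_fourier (f : 𝓢(V, ℂ)) : 𝓕 (𝓕 f) = dilation (-1) f := by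
  ext x
  have h_inv := DFunLike.congr_fun (SchwartzMap.fourierInv_apply_eq (𝓕 f)) (-x)
  rw [FourierTransform.fourierInv_fourier_eq] at h_inv
  simp [dilation_apply, h_inv]

theorem fourier_dilation {a : ℝ} (ha : a ≠ 0) (f : 𝓢(V, ℂ)) :
    𝓕 (dilation a f) = ((|a| ^ (-(finrank ℝ V : ℝ)) : ℝ) : ℂ) • dilation a⁻¹ (𝓕 f) := by
  ext x
  have h_subst := Measure.integral_comp_smul (volume : Measure V)
    (fun y => expPi (-2 * ⟪y, a⁻¹ • x⟫) * f y) a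
  have h_jacobian : |(a ^ finrank ℝ V)⁻¹| = |a| ^ (-(finrank ℝ V : ℝ)) := by
    rw [abs_inv, abs_pow, Real.rpow_neg (abs_nonneg a), Real.rpow_natCast]
  rw [smul_apply, dilation_apply (inv_ne_zero ha), fourier_apply_eq_integral_expPi,
    fourier_apply_eq_integral_expPi, Complex.coe_smul, ← h_jacobian, ← h_subst]
  refine integral_congr_ae (ae_of_all _ fun y => ?_)
  simp only [dilation_apply ha, inner_smul_left, inner_smul_right, conj_trivial,
    inv_mul_cancel_left₀ ha]

theorem continuousOn_integral_cexp_neg_mul {α : Type*} [MeasurableSpace α] {μ : Measure α}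
    {q : α → ℝ} (hq : ∀ x, 0 ≤ q x) (hq_meas : Measurable q) {φ : α → ℂ} (hφ : Integrable φ μ) :
    ContinuousOn (fun b : ℂ => ∫ x, Complex.exp (-b * q x) * φ x ∂μ) {b | 0 ≤ b.re} := by
  refine continuousOn_of_dominated (bound := fun x => ‖φ x‖) (fun b _ => ?_) (fun b hb => ?_)
    hφ.norm (ae_of_all _ fun x => by fun_prop)
  · exact (by fun_prop : Measurable fun x => Complex.exp (-b * q x)).aestronglyMeasurable.mul hφ.1
  · refine ae_of_all _ fun x => ?_
    rw [norm_mul, Complex.norm_exp]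
    refine mul_le_of_le_one_left (norm_nonneg _) (Real.exp_le_one_iff.mpr ?_)
    rw [Complex.re_mul_ofReal, Complex.neg_re, neg_mul, neg_nonpos]
    exact mul_nonneg hb (hq x)

theorem integral_gaussian_mul_fourier {b : ℂ} (hb : 0 < b.re) (f : 𝓢(V, ℂ)) (ξ : V) :
    ∫ z, Complex.exp (-b * (‖z‖ ^ 2 : ℝ)) * (expPi (-2 * ⟪ξ, z⟫) * 𝓕 f z) =
      (π / b) ^ (finrank ℝ V / 2 : ℂ) *
        ∫ y, Complex.exp (-(π ^ 2 / b) * (‖ξ + y‖ ^ 2 : ℝ)) * f y := by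
  have h_integrable :=
    GaussianFourier.integrable_cexp_neg_mul_sq_norm_add hb (2 * π * Complex.I) (-ξ)
  have h_flip := VectorFourier.integral_fourierIntegral_smul_eq_flip (L := innerₗ V)
    (μ := volume) (ν := volume) Real.continuous_fourierChar continuous_inner h_integrable
    f.integrable
  rw [flip_innerₗ] at h_flip
  calc _ = ∫ z, Complex.exp (-b * ‖z‖ ^ 2 + 2 * π * Complex.I * ⟪-ξ, z⟫) • 𝓕 f z := by
        refine integral_congr_ae (ae_of_all _ fun z => ?_)
        simp only [expPi, smul_eq_mul, ← mul_assoc, ← Complex.exp_add, inner_neg_left]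
        push_cast
        ring_nf
    _ = ∫ y, 𝓕 (fun z : V => Complex.exp (-b * ‖z‖ ^ 2 + 2 * π * Complex.I * ⟪-ξ, z⟫)) y • f y :=
        h_flip.symm
    _ = _ := by
        rw [← integral_const_mul]
        refine integral_congr_ae (ae_of_all _ fun y => ?_)
        simp only [fourier_gaussian_innerProductSpace' hb, ← neg_add', norm_neg, smul_eq_mul]
        push_cast
        ring_nf

theorem pi_div_mem_slitPlane {b : ℂ} (hb_re : 0 ≤ b.re) (hb : b ≠ 0) :
    (π / b : ℂ) ∈ Complex.slitPlane := by
  have h_norm : 0 < Complex.normSq b := Complex.normSq_pos.mpr hb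
  rw [Complex.mem_slitPlane_iff, div_eq_mul_inv, Complex.re_ofReal_mul, Complex.im_ofReal_mul,
    Complex.inv_re, Complex.inv_im]
  rcases hb_re.lt_or_eq with h | h
  · left; positivity
  · right
    have h_im : b.im ≠ 0 := fun h' => hb (Complex.ext h.symm h')
    exact mul_ne_zero Real.pi_ne_zero (div_ne_zero (neg_ne_zero.mpr h_im) h_norm.ne')

/-- The two sides are continuous in `b` up to the imaginary axis away from `0`, so the identity
extends to it from the right half plane. -/
theorem integral_gaussian_mul_fourier_of_re_nonneg {b : ℂ} (hb_re : 0 ≤ b.re) (hb : b ≠ 0)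
    (f : 𝓢(V, ℂ)) (ξ : V) :
    ∫ z, Complex.exp (-b * (‖z‖ ^ 2 : ℝ)) * (expPi (-2 * ⟪ξ, z⟫) * 𝓕 f z) =
      (π / b) ^ (finrank ℝ V / 2 : ℂ) *
        ∫ y, Complex.exp (-(π ^ 2 / b) * (‖ξ + y‖ ^ 2 : ℝ)) * f y := by
  have h_int : Integrable fun z => expPi (-2 * ⟪ξ, z⟫) * 𝓕 f z :=
    (𝓕 f).integrable.bdd_mul (c := 1)
      (hasTemperateGrowth_expPi.1.continuous.comp (by fun_prop)).aestronglyMeasurable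
      (ae_of_all _ fun _ => (norm_expPi _).le)
  have h_left := (continuousOn_integral_cexp_neg_mul (fun z : V => sq_nonneg ‖z‖) (by fun_prop)
    h_int).mono fun (b : ℂ) (hb : 0 ≤ b.re ∧ b ≠ 0) => hb.1
  have h_right : ContinuousOn (fun b : ℂ => (π / b) ^ (finrank ℝ V / 2 : ℂ) *
      ∫ y, Complex.exp (-(π ^ 2 / b) * (‖ξ + y‖ ^ 2 : ℝ)) * f y) {b | 0 ≤ b.re ∧ b ≠ 0} := by
    refine .mul ?_ ?_
    · exact (continuousOn_const.div continuousOn_id fun b hb => hb.2).cpow continuousOn_const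
        fun b hb => pi_div_mem_slitPlane hb.1 hb.2
    · refine (continuousOn_integral_cexp_neg_mul (fun y : V => sq_nonneg ‖ξ + y‖) (by fun_prop)
        f.integrable).comp ?_ ?_
      · exact continuousOn_const.div continuousOn_id fun b hb => hb.2
      · rintro b ⟨hb_re, -⟩
        rw [Set.mem_ofPred_eq, div_eq_mul_inv, ← Complex.ofReal_pow, Complex.re_ofReal_mul,
          Complex.inv_re]
        exact mul_nonneg (sq_nonneg π) (div_nonneg hb_re (Complex.normSq_nonneg b))
  refine Set.EqOn.of_subset_closure (s := {b : ℂ | 0 < b.re})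
    (fun b hb => integral_gaussian_mul_fourier hb f ξ) h_left h_right ?_ ?_ ⟨hb_re, hb⟩
  · rintro b (hb : 0 < b.re)
    exact ⟨hb.le, fun h => by simp [h] at hb⟩
  · rw [Complex.closure_setOfPred_lt_re]
    exact fun b hb => hb.1

theorem pi_div_neg_pi_mul_I_mul_cpow {t : ℝ} (ht : t ≠ 0) (r : ℝ) :
    (π / (-(π * Complex.I * t)) : ℂ) ^ (r : ℂ) =
      expPi (r * Real.sign t / 2) * ((|t| ^ (-r) : ℝ) : ℂ) := by
  have h_base :
      (π / (-(π * Complex.I * t)) : ℂ) = ((|t|⁻¹ : ℝ) : ℂ) * (Real.sign t * Complex.I) := by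
    have h_pi : (π : ℂ) ≠ 0 := by exact_mod_cast Real.pi_ne_zero
    have h_t : (t : ℂ) ≠ 0 := by exact_mod_cast ht
    have h_inv : (t⁻¹ : ℝ) = |t|⁻¹ * Real.sign t := by
      rcases ht.lt_or_gt with h | h
      · rw [abs_of_neg h, Real.sign_of_neg h, inv_neg]; ring
      · rw [abs_of_pos h, Real.sign_of_pos h, mul_one]
    rw [← mul_assoc, ← Complex.ofReal_mul, ← h_inv]
    push_cast
    field_simp
    simp
  have h_log : Complex.log (Real.sign t * Complex.I) = π * Complex.I * (Real.sign t / 2) := by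
    rcases ht.lt_or_gt with h | h
    · simp only [Real.sign_of_neg h, Complex.ofReal_neg, Complex.ofReal_one, neg_one_mul,
        Complex.log_neg_I]
      ring
    · simp only [Real.sign_of_pos h, Complex.ofReal_one, one_mul, Complex.log_I]
      ring
  have h_sign : (Real.sign t * Complex.I : ℂ) ≠ 0 :=
    mul_ne_zero (by exact_mod_cast Real.sign_eq_zero_iff.not.mpr ht) Complex.I_ne_zero
  rw [h_base, Complex.cpow_def_of_ne_zero (mul_ne_zero (by simpa using ht) h_sign),
    Complex.log_ofReal_mul (by positivity) h_sign, h_log, Real.log_inv, expPi,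
    Real.rpow_def_of_pos (abs_pos.mpr ht), Complex.ofReal_exp, ← Complex.exp_add]
  congr 1
  push_cast
  ring

theorem fourier_chirp_fourier {t : ℝ} (ht : t ≠ 0) (f : 𝓢(V, ℂ)) :
    𝓕 (chirp t (𝓕 f)) =
      (expPi (finrank ℝ V * Real.sign t / 4) * ((|t| ^ (-(finrank ℝ V : ℝ) / 2) : ℝ) : ℂ)) •
        chirp (-t⁻¹) (dilation t⁻¹ (𝓕 (chirp (-t⁻¹) f))) := by
  ext ξ
  have h_gauss := integral_gaussian_mul_fourier_of_re_nonneg (b := -(π * Complex.I * t))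
    (by simp) (by simp [Real.pi_ne_zero, ht]) f ξ
  have h_const := pi_div_neg_pi_mul_I_mul_cpow ht (finrank ℝ V / 2)
  push_cast at h_const
  rw [h_const] at h_gauss
  have h_left : 𝓕 (chirp t (𝓕 f)) ξ = ∫ z, Complex.exp (-(-(π * Complex.I * t)) *
      (‖z‖ ^ 2 : ℝ)) * (expPi (-2 * ⟪ξ, z⟫) * 𝓕 f z) := by
    rw [fourier_apply_eq_integral_expPi]
    refine integral_congr_ae (ae_of_all _ fun z => ?_)
    simp only [chirp_apply, expPi, real_inner_comm]
    push_cast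
    ring_nf
  have h_right : chirp (-t⁻¹) (dilation t⁻¹ (𝓕 (chirp (-t⁻¹) f))) ξ =
      ∫ y, Complex.exp (-(π ^ 2 / -(π * Complex.I * t)) * (‖ξ + y‖ ^ 2 : ℝ)) * f y := by
    rw [chirp_apply, dilation_apply (inv_ne_zero ht), fourier_apply_eq_integral_expPi,
      ← integral_const_mul]
    refine integral_congr_ae (ae_of_all _ fun y => ?_)
    simp only [chirp_apply, ← mul_assoc, ← expPi_add]
    rw [expPi, norm_add_sq_real, inner_smul_right, real_inner_comm]
    have h_pi : (π : ℂ) ≠ 0 := by exact_mod_cast Real.pi_ne_zero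
    have h_t : (t : ℂ) ≠ 0 := by exact_mod_cast ht
    congr 2
    push_cast
    field_simp
    simp only [Complex.I_sq]
    ring
  rw [h_left, h_gauss, smul_apply, h_right, smul_eq_mul]
  ring_nf

end Operators

section WeilOperator

variable {a b c d : ℝ} {g : SL2R}

theorem mul_sub_mul_eq_one (hg : g.1 = !![a, b; c, d]) : a * d - b * c = 1 := by
  rw [← Matrix.det_fin_two_of, ← hg]
  exact g.2

theorem coe_matS_mul (hg : g.1 = !![a, b; c, d]) : (matS * g).1 = !![-c, -d; a, b] := by
  rw [Matrix.SpecialLinearGroup.coe_mul, hg]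
  simp [matS]

theorem coe_unip_mul (u : ℝ) (hg : g.1 = !![a, b; c, d]) :
    (unip u * g).1 = !![a + u * c, b + u * d; c, d] := by
  rw [Matrix.SpecialLinearGroup.coe_mul, hg]
  simp [unip]

theorem coe_diagEl_mul {v : ℝ} (hv : 0 < v) (hg : g.1 = !![a, b; c, d]) :
    (diagEl v hv * g).1 = !![√v * a, √v * b; (√v)⁻¹ * c, (√v)⁻¹ * d] := by
  rw [Matrix.SpecialLinearGroup.coe_mul, hg]
  simp [diagEl]

variable {V : Type*} [NormedAddCommGroup V] [InnerProductSpace ℝ V] [FiniteDimensional ℝ V]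
  [MeasurableSpace V] [BorelSpace V]

/-- The projective Weil representation of `SL(2, ℝ)` on Schwartz functions on a Euclidean space,
assembled from chirps, dilations and the Fourier transform. -/
noncomputable def weilOp (g : SL2R) (f : 𝓢(V, ℂ)) : 𝓢(V, ℂ) :=
  if g.1 1 0 = 0 then
    ((|g.1 0 0| ^ ((finrank ℝ V : ℝ) / 2) : ℝ) : ℂ) •
      chirp (g.1 0 0 * g.1 0 1) (dilation (g.1 0 0) f)
  else
    ((|g.1 1 0| ^ (-(finrank ℝ V : ℝ) / 2) : ℝ) : ℂ) •
      chirp (g.1 0 0 / g.1 1 0) (dilation (g.1 1 0)⁻¹ (𝓕 (chirp (g.1 1 1 / g.1 1 0) f)))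

theorem weilOp_of_eq_zero (hg : g.1 = !![a, b; c, d]) (hc : c = 0) (f : 𝓢(V, ℂ)) :
    weilOp g f =
      ((|a| ^ ((finrank ℝ V : ℝ) / 2) : ℝ) : ℂ) • chirp (a * b) (dilation a f) := by
  simp [weilOp, hg, hc]

theorem weilOp_of_ne_zero (hg : g.1 = !![a, b; c, d]) (hc : c ≠ 0) (f : 𝓢(V, ℂ)) :
    weilOp g f = ((|c| ^ (-(finrank ℝ V : ℝ) / 2) : ℝ) : ℂ) •
      chirp (a / c) (dilation c⁻¹ (𝓕 (chirp (d / c) f))) := by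
  simp [weilOp, hg, hc]

theorem weilOp_matS (f : 𝓢(V, ℂ)) : weilOp matS f = 𝓕 f := by
  rw [weilOp_of_ne_zero (g := matS) rfl one_ne_zero]
  simp [chirp_zero, dilation_one]

theorem fourier_weilOp_of_eq_zero (hg : g.1 = !![a, b; c, d]) (hc : c = 0) (f : 𝓢(V, ℂ)) :
    𝓕 (weilOp g f) = weilOp (matS * g) f := by
  have h_det := mul_sub_mul_eq_one hg
  have ha : a ≠ 0 := by
    rintro rfl
    simp [hc] at h_det
  have h_swap : chirp (a * b) (dilation a f) = dilation a (chirp (b / a) f) := by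
    rw [dilation_chirp ha]
    congr 2
    field_simp
  have h_pow : |a| ^ ((finrank ℝ V : ℝ) / 2) * |a| ^ (-(finrank ℝ V : ℝ)) =
      |a| ^ (-(finrank ℝ V : ℝ) / 2) := by
    rw [← Real.rpow_add (abs_pos.mpr ha)]
    ring_nf
  rw [weilOp_of_eq_zero hg hc, weilOp_of_ne_zero (coe_matS_mul hg) ha, h_swap,
    FourierTransform.fourier_smul, fourier_dilation ha, smul_smul, ← Complex.ofReal_mul, h_pow,
    hc, neg_zero, zero_div, chirp_zero]

theorem fourier_weilOp_of_ne_zero (hg : g.1 = !![a, b; c, d]) (hc : c ≠ 0) (f : 𝓢(V, ℂ)) :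
    𝓕 (weilOp g f) = ((|c| ^ ((finrank ℝ V : ℝ) / 2) : ℝ) : ℂ) •
      dilation c (𝓕 (chirp (a * c) (𝓕 (chirp (d / c) f)))) := by
  have h_swap (k : 𝓢(V, ℂ)) :
      chirp (a / c) (dilation c⁻¹ k) = dilation c⁻¹ (chirp (a * c) k) := by
    rw [dilation_chirp (inv_ne_zero hc)]
    congr 2
    field_simp
  have h_pow : |c| ^ (-(finrank ℝ V : ℝ) / 2) * |c⁻¹| ^ (-(finrank ℝ V : ℝ)) =
      |c| ^ ((finrank ℝ V : ℝ) / 2) := by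
    rw [abs_inv, Real.inv_rpow (abs_nonneg _), ← Real.rpow_neg (abs_nonneg _),
      ← Real.rpow_add (abs_pos.mpr hc)]
    ring_nf
  rw [weilOp_of_ne_zero hg hc, h_swap, FourierTransform.fourier_smul,
    fourier_dilation (inv_ne_zero hc), smul_smul, ← Complex.ofReal_mul, h_pow, inv_inv]

theorem fourier_weilOp (hg : g.1 = !![a, b; c, d]) (f : 𝓢(V, ℂ)) :
    𝓕 (weilOp g f) =
      expPi (finrank ℝ V * Real.sign (a * c) / 4) • weilOp (matS * g) f := by
  by_cases hc : c = 0
  · simp [hc, fourier_weilOp_of_eq_zero hg hc]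
  rw [fourier_weilOp_of_ne_zero hg hc]
  by_cases ha : a = 0
  · rw [weilOp_of_eq_zero (coe_matS_mul hg) ha, ha, zero_mul, chirp_zero, fourier_fourier,
      dilation_dilation hc (by norm_num), dilation_chirp (by simpa using hc), Real.sign_zero,
      mul_zero, zero_div, expPi_zero, one_smul, abs_neg, mul_neg_one, neg_sq, neg_mul_neg]
    congr 3
    field_simp
  have hac := mul_ne_zero ha hc
  have h_pow : |c| ^ ((finrank ℝ V : ℝ) / 2) * |a * c| ^ (-(finrank ℝ V : ℝ) / 2) =
      |a| ^ (-(finrank ℝ V : ℝ) / 2) := by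
    rw [abs_mul, Real.mul_rpow (abs_nonneg a) (abs_nonneg c), mul_left_comm,
      ← Real.rpow_add (abs_pos.mpr hc), neg_div, add_neg_cancel, Real.rpow_zero, mul_one]
  have h_outer : c ^ 2 * -(a * c)⁻¹ = -c / a := by field_simp
  have h_dil : c * (a * c)⁻¹ = a⁻¹ := by field_simp
  have h_inner : -(a * c)⁻¹ + d / c = b / a := by
    field_simp
    linear_combination mul_sub_mul_eq_one hg
  rw [weilOp_of_ne_zero (coe_matS_mul hg) ha, fourier_chirp_fourier hac, map_smul,
    dilation_chirp hc, dilation_dilation hc (inv_ne_zero hac), chirp_chirp, h_outer, h_dil,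
    h_inner, smul_smul, smul_smul, mul_left_comm, ← Complex.ofReal_mul, h_pow]

theorem weilOp_unip_mul (u : ℝ) (g : SL2R) (f : 𝓢(V, ℂ)) :
    weilOp (unip u * g) f = chirp u (weilOp g f) := by
  obtain ⟨a, b, c, d, hg⟩ : ∃ a b c d, g.1 = !![a, b; c, d] := ⟨_, _, _, _, Matrix.eta_fin_two _⟩
  have h_det := mul_sub_mul_eq_one hg
  by_cases hc : c = 0
  · have h_coeff : (a + u * c) * (b + u * d) = u + a * b := by
      rw [hc] at h_det ⊢
      linear_combination u * h_det
    rw [weilOp_of_eq_zero (coe_unip_mul u hg) hc, weilOp_of_eq_zero hg hc, map_smul, chirp_chirp,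
      h_coeff, hc, mul_zero, add_zero]
  · have h_coeff : (a + u * c) / c = u + a / c := by
      field_simp
      ring
    rw [weilOp_of_ne_zero (coe_unip_mul u hg) hc, weilOp_of_ne_zero hg hc, map_smul, chirp_chirp,
      h_coeff]

theorem weilOp_diagEl_mul {v : ℝ} (hv : 0 < v) (g : SL2R) (f : 𝓢(V, ℂ)) :
    weilOp (diagEl v hv * g) f =
      ((v ^ ((finrank ℝ V : ℝ) / 4) : ℝ) : ℂ) • dilation √v (weilOp g f) := by
  obtain ⟨a, b, c, d, hg⟩ : ∃ a b c d, g.1 = !![a, b; c, d] := ⟨_, _, _, _, Matrix.eta_fin_two _⟩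
  have h_sqrt : √v ≠ 0 := (Real.sqrt_pos.mpr hv).ne'
  have h_pow (r : ℝ) : √v ^ (r / 2) = v ^ (r / 4) := by
    rw [Real.sqrt_eq_rpow, ← Real.rpow_mul hv.le]
    ring_nf
  by_cases hc : c = 0
  · have ha : a ≠ 0 := by
      rintro rfl
      simpa [hc] using mul_sub_mul_eq_one hg
    rw [weilOp_of_eq_zero (coe_diagEl_mul hv hg) (by rw [hc, mul_zero]), weilOp_of_eq_zero hg hc,
      map_smul, dilation_chirp h_sqrt, dilation_dilation h_sqrt ha, smul_smul,
      abs_mul, Real.mul_rpow (abs_nonneg _) (abs_nonneg _), abs_of_nonneg (Real.sqrt_nonneg v),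
      h_pow, Complex.ofReal_mul]
    congr 3
    ring
  · have h_inv : |(√v)⁻¹| ^ (-(finrank ℝ V : ℝ) / 2) = v ^ ((finrank ℝ V : ℝ) / 4) := by
      rw [abs_inv, abs_of_nonneg (Real.sqrt_nonneg v), Real.inv_rpow (Real.sqrt_nonneg v),
        ← Real.rpow_neg (Real.sqrt_nonneg v), neg_div, neg_neg, h_pow]
    have h_outer : √v * a / ((√v)⁻¹ * c) = √v ^ 2 * (a / c) := by field_simp
    have h_dil : ((√v)⁻¹ * c)⁻¹ = √v * c⁻¹ := by rw [mul_inv, inv_inv]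
    rw [weilOp_of_ne_zero (coe_diagEl_mul hv hg) (mul_ne_zero (inv_ne_zero h_sqrt) hc),
      weilOp_of_ne_zero hg hc, map_smul, dilation_chirp h_sqrt,
      dilation_dilation h_sqrt (inv_ne_zero hc), smul_smul, abs_mul,
      Real.mul_rpow (abs_nonneg _) (abs_nonneg _), h_inv, h_outer, h_dil, Complex.ofReal_mul,
      mul_div_mul_left _ _ (inv_ne_zero h_sqrt)]

end WeilOperator

/-! ### Transfer to matrices -/

section Transfer

open scoped Kronecker

variable {m n : ℕ}

theorem measurePreserving_uncurry {ι κ : Type*} [Fintype ι] [Fintype κ] :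
    MeasurePreserving (Function.uncurry : (ι → κ → ℝ) → (ι × κ → ℝ)) := by
  have h_meas : Measurable (Function.uncurry : (ι → κ → ℝ) → (ι × κ → ℝ)) :=
    (MeasurableEquiv.curry ι κ ℝ).symm.measurable
  refine ⟨h_meas, (Measure.pi_eq fun s hs => ?_).symm⟩
  have h_preimage : Function.uncurry ⁻¹' Set.univ.pi s =
      Set.univ.pi fun i => Set.univ.pi fun j => s (i, j) := by
    ext x
    simp only [Set.mem_preimage, Set.mem_univ_pi, Prod.forall, Function.uncurry_apply_pair]
  rw [Measure.map_apply h_meas (.univ_pi hs), h_preimage, volume_pi_pi]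
  simp only [volume_pi_pi, Fintype.prod_prod_type]

/-- The map `x ↦ A x` from matrices to a Euclidean space. It turns the quadratic form
`x ↦ tr(ᵗx (ᵗA A) x)` into the square of the Euclidean norm. -/
noncomputable def toEuclidean (A : GL (Fin m) ℝ) :
    (Fin m → Fin n → ℝ) ≃L[ℝ] EuclideanSpace ℝ (Fin m × Fin n) :=
  LinearEquiv.toContinuousLinearEquiv
    { toFun x := WithLp.toLp 2 fun p => (A.1 * Matrix.of x) p.1 p.2
      invFun y := Matrix.of.symm (A⁻¹.1 * Matrix.of fun i j => y (i, j))
      map_add' x y := by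
        ext p
        simp [← Matrix.of_add_of, Matrix.mul_add]
      map_smul' r x := by
        ext p
        simp [← Matrix.smul_of]
      left_inv x := by
        change Matrix.of.symm (A⁻¹.1 * (A.1 * Matrix.of x)) = x
        rw [← Matrix.mul_assoc, Units.inv_mul, Matrix.one_mul, Equiv.symm_apply_apply]
      right_inv y := by
        ext p
        change (A.1 * (A⁻¹.1 * Matrix.of fun i j => y (i, j))) p.1 p.2 = y p
        rw [← Matrix.mul_assoc, Units.mul_inv, Matrix.one_mul]
        rfl }

theorem toEuclidean_apply (A : GL (Fin m) ℝ) (x : Fin m → Fin n → ℝ) (p : Fin m × Fin n) :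
    toEuclidean A x p = (A.1 * Matrix.of x) p.1 p.2 :=
  rfl

theorem inner_toEuclidean (A : GL (Fin m) ℝ) (x y : Fin m → Fin n → ℝ) :
    ⟪toEuclidean A x, toEuclidean A y⟫ = bil (A.1ᵀ * A.1) (Matrix.of x) (Matrix.of y) := by
  have h_bil : (Matrix.of x)ᵀ * (A.1ᵀ * A.1) * Matrix.of y =
      (A.1 * Matrix.of x)ᵀ * (A.1 * Matrix.of y) := by
    simp only [Matrix.transpose_mul, Matrix.mul_assoc]
  simp only [bil, h_bil, PiLp.inner_apply, Matrix.trace, Fintype.sum_prod_type_right,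
    Matrix.diag_apply, Matrix.mul_apply (M := (A.1 * Matrix.of x)ᵀ), Matrix.transpose_apply,
    toEuclidean_apply, Real.inner_apply]

theorem norm_sq_toEuclidean (A : GL (Fin m) ℝ) (x : Fin m → Fin n → ℝ) :
    ‖toEuclidean A x‖ ^ 2 = bil (A.1ᵀ * A.1) (Matrix.of x) (Matrix.of x) := by
  rw [← real_inner_self_eq_norm_sq, inner_toEuclidean]

theorem map_toEuclidean_volume (A : GL (Fin m) ℝ) :
    Measure.map (toEuclidean (n := n) A) volume = ENNReal.ofReal (|A.1.det| ^ n)⁻¹ • volume := by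
  set K : Matrix (Fin m × Fin n) (Fin m × Fin n) ℝ := A.1 ⊗ₖ 1
  have h_det : K.det = A.1.det ^ n := by
    rw [Matrix.det_kronecker, Matrix.det_one, one_pow, mul_one, Fintype.card_fin]
  have h_comp : (toEuclidean (n := n) A : (Fin m → Fin n → ℝ) → _) =
      WithLp.toLp 2 ∘ Matrix.toLin' K ∘ Function.uncurry := by
    ext x p
    simp [K, toEuclidean_apply, Matrix.mulVec, dotProduct, Matrix.mul_apply,
      Fintype.sum_prod_type, Matrix.one_apply]
  have h_toLin := (LinearMap.continuous_on_pi (Matrix.toLin' K)).measurable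
  have h_uncurry := measurePreserving_uncurry (ι := Fin m) (κ := Fin n)
  have h_toLp := PiLp.volume_preserving_toLp (Fin m × Fin n)
  have h_ne : K.det ≠ 0 := by
    rw [h_det]
    exact pow_ne_zero _ (A.det.ne_zero)
  rw [h_comp, ← Measure.map_map h_toLp.measurable (h_toLin.comp h_uncurry.measurable),
    ← Measure.map_map h_toLin h_uncurry.measurable, h_uncurry.map_eq,
    Real.map_matrix_volume_pi_eq_smul_volume_pi h_ne, Measure.map_smul, h_toLp.map_eq, h_det,
    abs_inv, abs_pow]

theorem integral_comp_toEuclidean (A : GL (Fin m) ℝ)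
    (F : EuclideanSpace ℝ (Fin m × Fin n) → ℂ) :
    ∫ x, F (toEuclidean A x) = (((|A.1.det| ^ n)⁻¹ : ℝ) : ℂ) * ∫ y, F y := by
  have h_map : ∫ y, F y ∂(Measure.map (toEuclidean A) volume) = ∫ x, F (toEuclidean A x) :=
    integral_map_equiv (toEuclidean (n := n) A).toHomeomorph.toMeasurableEquiv F
  rw [← h_map, map_toEuclidean_volume, integral_smul_measure,
    ENNReal.toReal_ofReal (by positivity), Complex.real_smul]

/-- Composition of Schwartz functions with `toEuclidean A`. -/
noncomputable def pullback (A : GL (Fin m) ℝ) (f : 𝓢(EuclideanSpace ℝ (Fin m × Fin n), ℂ)) :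
    𝓢(Fin m → Fin n → ℝ, ℂ) :=
  SchwartzMap.compCLMOfContinuousLinearEquiv ℂ (toEuclidean A) f

theorem onMat_pullback_apply (A : GL (Fin m) ℝ) (f : 𝓢(EuclideanSpace ℝ (Fin m × Fin n), ℂ))
    (x : RMat m n) : onMat (pullback A f) x = f (toEuclidean A (Matrix.of.symm x)) :=
  rfl

theorem pullback_surjective (A : GL (Fin m) ℝ) : Function.Surjective (pullback (n := n) A) :=
  fun f => ⟨SchwartzMap.compCLMOfContinuousLinearEquiv ℂ (toEuclidean A).symm f, by
    ext x
    simp [pullback]⟩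

theorem det_transpose_mul_self_rpow (A : RMat m m) (n : ℕ) :
    (Aᵀ * A).det ^ ((n : ℝ) / 2) = |A.det| ^ n := by
  rw [Matrix.det_mul, Matrix.det_transpose, ← abs_mul_abs_self, ← sq, ← Real.rpow_natCast,
    ← Real.rpow_mul (abs_nonneg _), ← Real.rpow_natCast, Nat.cast_ofNat,
    mul_div_cancel₀ _ (two_ne_zero' ℝ)]

theorem fourier_chirp_toEuclidean (A : GL (Fin m) ℝ) (s t : ℝ)
    (f : 𝓢(EuclideanSpace ℝ (Fin m × Fin n), ℂ)) (x : RMat m n) :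
    𝓕 (chirp t f) (s • toEuclidean A (Matrix.of.symm x)) =
      (((A.1ᵀ * A.1).det ^ ((n : ℝ) / 2) : ℝ) : ℂ) * ∫ y : Fin m → Fin n → ℝ,
        expPi (t * bil (A.1ᵀ * A.1) (Matrix.of y) (Matrix.of y)
          - 2 * (s * bil (A.1ᵀ * A.1) (Matrix.of y) x)) * onMat (pullback A f) (Matrix.of y) := by
  have h_subst := integral_comp_toEuclidean A fun y =>
    expPi (-2 * ⟪y, s • toEuclidean A (Matrix.of.symm x)⟫) * chirp t f y
  have h_det : ((|A.1.det| ^ n : ℝ) : ℂ) ≠ 0 :=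
    Complex.ofReal_ne_zero.mpr (pow_ne_zero _ (abs_ne_zero.mpr A.det.ne_zero))
  rw [fourier_apply_eq_integral_expPi, det_transpose_mul_self_rpow,
    eq_comm, ← eq_inv_mul_iff_mul_eq₀ h_det, ← Complex.ofReal_inv, ← h_subst]
  refine integral_congr_ae (ae_of_all _ fun y => ?_)
  simp only [inner_smul_right, inner_toEuclidean, Equiv.apply_symm_apply, chirp_apply,
    norm_sq_toEuclidean, ← mul_assoc, ← expPi_add, onMat_pullback_apply, Equiv.symm_apply_apply]
  ring_nf

theorem bil_comm {M : RMat m m} (hM : M.IsSymm) (x y : RMat m n) : bil M x y = bil M y x := by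
  rw [bil, bil, ← Matrix.trace_transpose]
  simp only [Matrix.transpose_mul, Matrix.transpose_transpose, hM.eq, Matrix.mul_assoc]

theorem weil_pullback (A : GL (Fin m) ℝ) (g : SL2R)
    (f : 𝓢(EuclideanSpace ℝ (Fin m × Fin n), ℂ)) :
    weil (A.1ᵀ * A.1) g (onMat (pullback A f)) = onMat (pullback A (weilOp g f)) := by
  have h_finrank : (finrank ℝ (EuclideanSpace ℝ (Fin m × Fin n)) : ℝ) = m * n := by simp
  obtain ⟨a, b, c, d, hg⟩ : ∃ a b c d, g.1 = !![a, b; c, d] := ⟨_, _, _, _, Matrix.eta_fin_two _⟩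
  ext x
  have h_sq : ‖toEuclidean A (Matrix.of.symm x)‖ ^ 2 = bil (A.1ᵀ * A.1) x x :=
    norm_sq_toEuclidean A _
  by_cases hc : c = 0
  · have ha : a ≠ 0 := by
      rintro rfl
      simpa [hc] using mul_sub_mul_eq_one hg
    have h_smul : toEuclidean A (Matrix.of.symm (a • x)) =
        a • toEuclidean A (Matrix.of.symm x) := map_smul (toEuclidean A) a (Matrix.of.symm x)
    rw [onMat_pullback_apply, weilOp_of_eq_zero hg hc, smul_apply, chirp_apply,
      dilation_apply ha, h_finrank, h_sq, ← h_smul]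
    simp [weil, hg, hc, expPi, onMat_pullback_apply, mul_assoc]
  · have h_symm : (A.1ᵀ * A.1).IsSymm := Matrix.isSymm_transpose_mul_self _
    rw [onMat_pullback_apply, weilOp_of_ne_zero hg hc, smul_apply, chirp_apply,
      dilation_apply (inv_ne_zero hc), fourier_chirp_toEuclidean, h_finrank, h_sq, smul_eq_mul,
      mul_left_comm (expPi _), ← integral_const_mul, ← mul_assoc, mul_comm (Complex.ofReal _),
      ← Complex.ofReal_mul]
    simp only [weil, hg, Matrix.of_apply, Matrix.cons_val_one, Matrix.cons_val_zero, if_neg hc]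
    congr 2
    funext y
    rw [← mul_assoc, ← expPi_add, bil_comm h_symm (Matrix.of y) x, ← expPi]
    congr 2
    field_simp
    ring

theorem exists_eq_transpose_mul_self {M : RMat m m} (hM : M.PosDef) :
    ∃ A : GL (Fin m) ℝ, M = A.1ᵀ * A.1 := by
  open scoped MatrixOrder in
  obtain ⟨B, hB⟩ := CStarAlgebra.nonneg_iff_eq_star_mul_self.mp hM.posSemidef.nonneg
  have h_det := hM.det_pos
  rw [hB, Matrix.det_mul] at h_det
  exact ⟨.mkOfDetNeZero B (right_ne_zero_of_mul h_det.ne'), hB⟩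

end Transfer

/-! ### The Schrödinger–Weil representation on Schwartz functions -/

section SchrodingerWeil

variable {m n : ℕ}

theorem bil_add_left (M : RMat m m) (x y z : RMat m n) :
    bil M (x + y) z = bil M x z + bil M y z := by
  simp only [bil, Matrix.transpose_add, Matrix.add_mul, Matrix.trace_add]

theorem bil_add_right (M : RMat m m) (x y z : RMat m n) :
    bil M x (y + z) = bil M x y + bil M x z := by
  simp only [bil, Matrix.mul_add, Matrix.trace_add]

theorem bil_smul_left (M : RMat m m) (r : ℝ) (x y : RMat m n) :
    bil M (r • x) y = r * bil M x y := by
  simp only [bil, Matrix.transpose_smul, Matrix.smul_mul, Matrix.trace_smul, smul_eq_mul]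

theorem bil_smul_right (M : RMat m m) (r : ℝ) (x y : RMat m n) :
    bil M x (r • y) = r * bil M x y := by
  simp only [bil, Matrix.mul_smul, Matrix.trace_smul, smul_eq_mul]

theorem bil_neg_left (M : RMat m m) (x y : RMat m n) : bil M (-x) y = -bil M x y := by
  rw [← neg_one_smul ℝ, bil_smul_left, neg_one_mul]

theorem bil_sub_left (M : RMat m m) (x y z : RMat m n) :
    bil M (x - y) z = bil M x z - bil M y z := by
  rw [sub_eq_add_neg, bil_add_left, bil_neg_left, sub_eq_add_neg]

theorem bil_sub_right (M : RMat m m) (x y z : RMat m n) :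
    bil M x (y - z) = bil M x y - bil M x z := by
  rw [sub_eq_add_neg, bil_add_right, ← neg_one_smul ℝ, bil_smul_right, neg_one_mul,
    sub_eq_add_neg]

theorem trace_mul_mul_transpose (M : RMat m m) (x y : RMat m n) :
    (M * (x * yᵀ)).trace = bil M y x := by
  rw [bil, Matrix.mul_assoc, Matrix.trace_mul_comm yᵀ, Matrix.mul_assoc]

theorem schrodinger_apply (M : RMat m m) (h : Heis m n) (F : RMat m n → ℂ) (x : RMat m n) :
    schrodinger M h F x =
      expPi ((M * h.kap).trace + bil M h.lam h.mu + 2 * bil M h.mu x) * F (x + h.lam) := by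
  simp only [schrodinger, expPi, Matrix.mul_add, Matrix.trace_add, Matrix.mul_smul,
    Matrix.trace_smul, trace_mul_mul_transpose, smul_eq_mul]

theorem schrodinger_mul {M : RMat m m} (hM : M.IsSymm) (h k : Heis m n) (F : RMat m n → ℂ) :
    schrodinger M (h * k) F = schrodinger M h (schrodinger M k F) := by
  have h_lam : (h * k).lam = h.lam + k.lam := rfl
  have h_mu : (h * k).mu = h.mu + k.mu := rfl
  have h_kap : (h * k).kap = h.kap + k.kap + h.lam * k.muᵀ - h.mu * k.lamᵀ := rfl
  ext x
  simp only [schrodinger_apply, h_lam, h_mu, h_kap, Matrix.mul_add, Matrix.mul_sub,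
    Matrix.trace_add, Matrix.trace_sub, trace_mul_mul_transpose, ← mul_assoc, ← expPi_add,
    bil_add_left, bil_add_right, add_assoc, bil_comm hM h.lam k.mu]
  congr 2
  ring

theorem schrodinger_smul (M : RMat m m) (h : Heis m n) (r : ℂ) (F : RMat m n → ℂ) :
    schrodinger M h (r • F) = r • schrodinger M h F := by
  ext x
  simp only [schrodinger_apply, Pi.smul_apply, smul_eq_mul, mul_left_comm r]

/-- The Heisenberg component `(-μ, λ; κ)` of the left translate of `(λ, μ; κ)` by `matS`. -/
def Heis.inversion (h : Heis m n) : Heis m n := ⟨-h.mu, h.lam, h.kap, h.isSymm_inversion⟩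

/-- The Heisenberg component `(λ, s - 2λ + μ; κ - s ᵗλ)` of the left translate of `(λ, μ; κ)` by
`unip 2` and `(0, s)`. -/
def Heis.shift (h : Heis m n) (s : RMat m n) : Heis m n :=
  ⟨h.lam, s - (2 : ℝ) • h.lam + h.mu, h.kap - s * h.lamᵀ, h.isSymm_shift s⟩

theorem weil_matS_apply (M : RMat m m) (F : RMat m n → ℂ) (x : RMat m n) :
    weil M matS F x = ((M.det ^ ((n : ℝ) / 2) : ℝ) : ℂ) *
      ∫ y : Fin m → Fin n → ℝ, expPi (-2 * bil M x (Matrix.of y)) * F (Matrix.of y) := by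
  simp [weil, matS, expPi]

theorem weil_matS_schrodinger {M : RMat m m} (hM : M.IsSymm) (h : Heis m n)
    (F : RMat m n → ℂ) :
    weil M matS (schrodinger M h F) = schrodinger M h.inversion (weil M matS F) := by
  ext x
  have h_translate : ∫ y : Fin m → Fin n → ℝ,
      expPi (-2 * bil M x (Matrix.of y)) * schrodinger M h F (Matrix.of y) =
      ∫ y : Fin m → Fin n → ℝ,
        expPi ((M * h.kap).trace - bil M h.mu h.lam + 2 * bil M h.lam x) *
          (expPi (-2 * bil M (x - h.mu) (Matrix.of y)) * F (Matrix.of y)) := by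
    refine .trans (integral_congr_ae (ae_of_all _ fun y => ?_))
      (integral_add_right_eq_self _ (Matrix.of.symm h.lam))
    have h_of : Matrix.of (y + Matrix.of.symm h.lam) = Matrix.of y + h.lam := rfl
    simp only [schrodinger_apply, h_of, ← mul_assoc, ← expPi_add, bil_sub_left, bil_add_right,
      bil_comm hM h.lam x, bil_comm hM h.lam h.mu]
    congr 2
    ring
  rw [weil_matS_apply, h_translate, integral_const_mul, schrodinger_apply, weil_matS_apply,
    mul_left_comm]
  simp only [Heis.inversion, bil_neg_left, ← sub_eq_add_neg]

/-- The functions of a matrix which are Schwartz functions of its entries. -/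
def IsSchwartz (F : RMat m n → ℂ) : Prop := ∃ f : 𝓢(Fin m → Fin n → ℝ, ℂ), F = onMat f

theorem isSchwartz_onMat (f : 𝓢(Fin m → Fin n → ℝ, ℂ)) : IsSchwartz (onMat f) := ⟨f, rfl⟩

theorem IsSchwartz.exists_eq_pullback {F : RMat m n → ℂ} (hF : IsSchwartz F)
    (A : GL (Fin m) ℝ) : ∃ f, F = onMat (pullback A f) := by
  obtain ⟨f, rfl⟩ := hF
  obtain ⟨f, rfl⟩ := pullback_surjective A f
  exact ⟨f, rfl⟩

theorem IsSchwartz.schrodinger {F : RMat m n → ℂ} (hF : IsSchwartz F) (M : RMat m m)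
    (h : Heis m n) : IsSchwartz (schrodinger M h F) := by
  obtain ⟨f, rfl⟩ := hF
  let L : (Fin m → Fin n → ℝ) →ₗ[ℝ] ℝ :=
    { toFun x := bil M h.mu (Matrix.of x)
      map_add' x y := bil_add_right M _ _ _
      map_smul' r x := bil_smul_right M r _ _ }
  let phase (x : Fin m → Fin n → ℝ) : ℂ :=
    expPi ((M * h.kap).trace + bil M h.lam h.mu + 2 * L.toContinuousLinearMap x)
  have h_growth : Function.HasTemperateGrowth phase :=
    hasTemperateGrowth_expPi.comp ((Function.HasTemperateGrowth.const _).add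
      ((Function.HasTemperateGrowth.const 2).mul L.toContinuousLinearMap.hasTemperateGrowth))
  refine ⟨SchwartzMap.smulLeftCLM ℂ phase
    (SchwartzMap.compSubConstCLM ℂ (-Matrix.of.symm h.lam) f), ?_⟩
  ext x
  rw [schrodinger_apply, onMat, onMat, SchwartzMap.smulLeftCLM_apply_apply h_growth,
    SchwartzMap.compSubConstCLM_apply, sub_neg_eq_add, smul_eq_mul]
  rfl

variable {M : RMat m m} {F : RMat m n → ℂ}

theorem IsSchwartz.weil (hM : M.PosDef) (hF : IsSchwartz F) (g : SL2R) :
    IsSchwartz (weil M g F) := by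
  obtain ⟨A, rfl⟩ := exists_eq_transpose_mul_self hM
  obtain ⟨f, rfl⟩ := hF.exists_eq_pullback A
  exact ⟨_, weil_pullback A g f⟩

theorem IsSchwartz.jacobiRep (hM : M.PosDef) (hF : IsSchwartz F) (h : Heis m n) (g : SL2R) :
    IsSchwartz (jacobiRep M h g F) :=
  (hF.weil hM g).schrodinger M h

theorem cocycle_eq_expPi (g₁ g₂ : SL2R) : cocycle m n g₁ g₂ =
    expPi (-(m * n * Real.sign (g₁.1 1 0 * g₂.1 1 0 * (g₁ * g₂).1 1 0) / 4)) := by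
  rw [cocycle, expPi]
  push_cast
  ring_nf

theorem norm_cocycle (g₁ g₂ : SL2R) : ‖cocycle m n g₁ g₂‖ = 1 := by
  rw [cocycle_eq_expPi, norm_expPi]

theorem weil_matS_mul (hM : M.PosDef) (hF : IsSchwartz F) (g : SL2R) :
    weil M (matS * g) F = cocycle m n matS g • weil M matS (weil M g F) := by
  obtain ⟨A, rfl⟩ := exists_eq_transpose_mul_self hM
  obtain ⟨f, rfl⟩ := hF.exists_eq_pullback A
  obtain ⟨a, b, c, d, hg⟩ : ∃ a b c d, g.1 = !![a, b; c, d] := ⟨_, _, _, _, Matrix.eta_fin_two _⟩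
  have h_cocycle : cocycle m n matS g = expPi (-(m * n * Real.sign (a * c) / 4)) := by
    rw [cocycle_eq_expPi, coe_matS_mul hg, hg]
    simp [matS, mul_comm c]
  have h_finrank : (finrank ℝ (EuclideanSpace ℝ (Fin m × Fin n)) : ℝ) = m * n := by simp
  rw [weil_pullback, weil_pullback, weil_pullback, weilOp_matS, fourier_weilOp hg, h_finrank,
    h_cocycle]
  ext x
  rw [Pi.smul_apply, onMat_pullback_apply, onMat_pullback_apply, smul_apply, smul_smul,
    ← expPi_add, neg_add_cancel, expPi_zero, one_smul]

theorem weil_unip_mul (hM : M.PosDef) (hF : IsSchwartz F) (u : ℝ) (g : SL2R) (x : RMat m n) :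
    weil M (unip u * g) F x = expPi (u * bil M x x) * weil M g F x := by
  obtain ⟨A, rfl⟩ := exists_eq_transpose_mul_self hM
  obtain ⟨f, rfl⟩ := hF.exists_eq_pullback A
  rw [weil_pullback, weil_pullback, weilOp_unip_mul, onMat_pullback_apply, onMat_pullback_apply,
    chirp_apply, norm_sq_toEuclidean, Equiv.apply_symm_apply]

theorem weil_diagEl_mul (hM : M.PosDef) (hF : IsSchwartz F) {v : ℝ} (hv : 0 < v) (g : SL2R)
    (x : RMat m n) :
    weil M (diagEl v hv * g) F x =
      ((v ^ ((m * n : ℝ) / 4) : ℝ) : ℂ) * weil M g F (√v • x) := by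
  obtain ⟨A, rfl⟩ := exists_eq_transpose_mul_self hM
  obtain ⟨f, rfl⟩ := hF.exists_eq_pullback A
  have h_finrank : (finrank ℝ (EuclideanSpace ℝ (Fin m × Fin n)) : ℝ) = m * n := by simp
  rw [weil_pullback, weil_pullback, weilOp_diagEl_mul, onMat_pullback_apply,
    onMat_pullback_apply, smul_apply, dilation_apply (Real.sqrt_pos.mpr hv).ne', h_finrank,
    smul_eq_mul, ← map_smul]
  rfl

end SchrodingerWeil

/-! ### Sums over integral matrices -/

section LatticeSum

variable {m n : ℕ}

/-- The theta functional `F ↦ ∑ F ω`, summed over all integral matrices `ω`. -/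
noncomputable def latticeSum (F : RMat m n → ℂ) : ℂ := ∑' ω : ZMat m n, F (toReal ω)

theorem latticeSum_smul (r : ℂ) (F : RMat m n → ℂ) :
    latticeSum (r • F) = r * latticeSum F :=
  tsum_mul_left

theorem toReal_mul {k : ℕ} (A : ZMat m n) (B : ZMat n k) :
    toReal (A * B) = toReal A * toReal B :=
  Matrix.map_mul (f := Int.castRingHom ℝ)

theorem exists_bil_toReal_eq_intCast (M : ZMat m m) (x y : ZMat m n) :
    ∃ k : ℤ, bil (toReal M) (toReal x) (toReal y) = k := by
  have h_bil : bil (toReal M) (toReal x) (toReal y) = (toReal (xᵀ * M * y)).trace := by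
    rw [toReal_mul, toReal_mul]
    rfl
  exact ⟨(xᵀ * M * y).trace, h_bil.trans (AddMonoidHom.map_trace (Int.castAddHom ℝ) _).symm⟩

theorem toEuclidean_one_toReal (ω : ZMat m n) :
    toEuclidean 1 (Matrix.of.symm (toReal ω)) = intPoint (Function.uncurry ω) := by
  ext p
  rw [toEuclidean_apply, Units.val_one, Matrix.one_mul]
  rfl

theorem IsSchwartz.summable_toReal {F : RMat m n → ℂ} (hF : IsSchwartz F) :
    Summable fun ω : ZMat m n => F (toReal ω) := by
  obtain ⟨f, rfl⟩ := hF.exists_eq_pullback 1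
  simp only [onMat_pullback_apply, toEuclidean_one_toReal]
  exact (Equiv.curry (Fin m) (Fin n) ℤ).symm.summable_iff.mpr (summable_schwartz_intPoint f)

theorem latticeSum_onMat_pullback_one (f : 𝓢(EuclideanSpace ℝ (Fin m × Fin n), ℂ)) :
    latticeSum (onMat (pullback 1 f)) = ∑' k : Fin m × Fin n → ℤ, f (intPoint k) := by
  simp only [latticeSum, onMat_pullback_apply, toEuclidean_one_toReal]
  exact (Equiv.curry (Fin m) (Fin n) ℤ).symm.tsum_eq fun k => f (intPoint k)

theorem latticeSum_weil_one_matS {F : RMat m n → ℂ} (hF : IsSchwartz F) :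
    latticeSum (weil 1 matS F) = latticeSum F := by
  obtain ⟨f, rfl⟩ := hF.exists_eq_pullback 1
  have h_weil := weil_pullback 1 matS f
  rw [Units.val_one, Matrix.transpose_one, Matrix.one_mul, weilOp_matS] at h_weil
  rw [h_weil, latticeSum_onMat_pullback_one, latticeSum_onMat_pullback_one,
    ← tsum_schwartz_intPoint_eq_tsum_fourier]

theorem weil_matS_eq_weil_one_matS {M : RMat m m} (hM : M.IsSymm) (F : RMat m n → ℂ)
    (x : RMat m n) :
    weil M matS F x = ((M.det ^ ((n : ℝ) / 2) : ℝ) : ℂ) * weil 1 matS F (M * x) := by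
  have h_bil (y : RMat m n) : bil M x y = bil 1 (M * x) y := by
    simp only [bil, Matrix.transpose_mul, hM.eq, Matrix.mul_one]
  simp only [weil_matS_apply, h_bil, Matrix.det_one, Real.one_rpow, Complex.ofReal_one, one_mul]

theorem isUnit_of_range_mul_eq_univ (hn : 0 < n) {M : ZMat m m}
    (h_range : Set.range (fun ω : ZMat m n => M * ω) = Set.univ) : IsUnit M := by
  have h_column (i : Fin m) : ∃ ω : ZMat m n, M * ω = Matrix.of fun j _ => (1 : ZMat m m) j i :=
    Set.range_eq_univ.mp h_range _
  choose ω hω using h_column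
  refine IsUnit.of_mul_eq_one (Matrix.of fun j i => ω i j ⟨0, hn⟩) ?_
  ext j i
  exact congrFun₂ (hω i) j ⟨0, hn⟩

theorem det_toReal_eq_one {M : ZMat m m} (hM : (toReal M).PosDef) (hM_unit : IsUnit M) :
    (toReal M).det = 1 := by
  have h_det : (toReal M).det = (M.det : ℝ) := ((Int.castRingHom ℝ).map_det M).symm
  have h_pos : 0 < (M.det : ℝ) := h_det ▸ hM.det_pos
  rcases Int.isUnit_iff.mp ((Matrix.isUnit_iff_isUnit_det M).mp hM_unit) with h | h
  · rw [h_det, h, Int.cast_one]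
  · norm_num [h] at h_pos

theorem isSymm_of_posDef {M : RMat m m} (hM : M.PosDef) : M.IsSymm :=
  (Matrix.conjTranspose_eq_transpose_of_trivial M).symm.trans hM.isHermitian

variable {M : ZMat m m} {F : RMat m n → ℂ}

theorem latticeSum_weil_matS (hM : (toReal M).PosDef) (hM_unit : IsUnit M) (hF : IsSchwartz F) :
    latticeSum (weil (toReal M) matS F) = latticeSum F := by
  obtain ⟨U, rfl⟩ := hM_unit
  let e : ZMat m n ≃ ZMat m n :=
    { toFun ω := U.1 * ω
      invFun ω := U⁻¹.1 * ω
      left_inv ω := by simp only [← Matrix.mul_assoc, Units.inv_mul, Matrix.one_mul]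
      right_inv ω := by simp only [← Matrix.mul_assoc, Units.mul_inv, Matrix.one_mul] }
  calc latticeSum (weil (toReal U.1) matS F)
      = ∑' ω : ZMat m n, weil 1 matS F (toReal (e ω)) := by
        simp only [latticeSum, weil_matS_eq_weil_one_matS (isSymm_of_posDef hM),
          det_toReal_eq_one hM U.isUnit, Real.one_rpow, Complex.ofReal_one, one_mul, e, toReal_mul,
          Equiv.coe_fn_mk]
    _ = latticeSum (weil 1 matS F) := e.tsum_eq fun ω => weil 1 matS F (toReal ω)
    _ = latticeSum F := latticeSum_weil_one_matS hF

theorem latticeSum_schrodinger_of_isIntegral (M : ZMat m m) {h : Heis m n} (hh : h.IsIntegral)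
    (F : RMat m n → ℂ) :
    latticeSum (schrodinger (toReal M) h F) =
      expPi (toReal M * (h.kap + h.mu * h.lamᵀ)).trace * latticeSum F := by
  obtain ⟨l, u, -, h_lam, h_mu, -⟩ := hh
  rw [latticeSum, latticeSum, ← tsum_mul_left,
    ← (Equiv.addRight l).tsum_eq fun ω => _ * F (toReal ω)]
  refine tsum_congr fun ω => ?_
  obtain ⟨k, hk⟩ := exists_bil_toReal_eq_intCast M u ω
  have h_add : toReal ω + h.lam = toReal (ω + l) := by
    rw [h_lam]
    exact (Matrix.map_add _ Int.cast_add ω l).symm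
  rw [schrodinger_apply, Matrix.mul_add, Matrix.trace_add, trace_mul_mul_transpose, h_add, h_mu, hk,
    expPi_add _ (2 * (k : ℝ)), expPi_two_mul_intCast, mul_one, Equiv.coe_addRight]

theorem latticeSum_jacobiRep_matS_mul (hM : (toReal M).PosDef) (hM_unit : IsUnit M)
    (hF : IsSchwartz F) (h : Heis m n) (g : SL2R) :
    latticeSum (jacobiRep (toReal M) h.inversion (matS * g) F) =
      cocycle m n matS g * latticeSum (jacobiRep (toReal M) h g F) := by
  rw [jacobiRep, weil_matS_mul hM hF, schrodinger_smul, latticeSum_smul,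
    ← weil_matS_schrodinger (isSymm_of_posDef hM), ← jacobiRep,
    latticeSum_weil_matS hM hM_unit (hF.jacobiRep hM h g)]

theorem latticeSum_jacobiRep_unip_two_mul (hM : (toReal M).PosDef) (hF : IsSchwartz F)
    (h : Heis m n) (s : ZMat m n) (g : SL2R) :
    latticeSum (jacobiRep (toReal M) (h.shift (toReal s)) (unip 2 * g) F) =
      latticeSum (jacobiRep (toReal M) h g F) := by
  refine tsum_congr fun ω => ?_
  obtain ⟨k, hk⟩ := exists_bil_toReal_eq_intCast M s ω
  obtain ⟨l, hl⟩ := exists_bil_toReal_eq_intCast M ω ω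
  have h_symm (x y : RMat m n) := bil_comm (isSymm_of_posDef hM) x y
  rw [jacobiRep, jacobiRep, schrodinger_apply, schrodinger_apply, weil_unip_mul hM hF, ← mul_assoc,
    ← expPi_add, ← mul_one (expPi (_ + 2 * bil _ h.mu _)), ← expPi_two_mul_intCast (k + l),
    ← expPi_add]
  congr 2
  simp only [Heis.shift, Matrix.mul_sub, Matrix.trace_sub, trace_mul_mul_transpose, bil_add_left,
    bil_add_right, bil_sub_left, bil_sub_right, bil_smul_left, bil_smul_right, Int.cast_add, hk, hl,
    h_symm (toReal ω) h.lam]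
  ring

theorem latticeSum_jacobiRep_mul (hM : (toReal M).IsSymm) {h₀ : Heis m n} (h₀_int : h₀.IsIntegral)
    (h : Heis m n) (g : SL2R) (F : RMat m n → ℂ) :
    latticeSum (jacobiRep (toReal M) (h₀ * h) g F) =
      expPi (toReal M * (h₀.kap + h₀.mu * h₀.lamᵀ)).trace *
        latticeSum (jacobiRep (toReal M) h g F) := by
  rw [jacobiRep, schrodinger_mul hM, latticeSum_schrodinger_of_isIntegral M h₀_int, jacobiRep]

end LatticeSum

/-! ### Iwasawa coordinates -/

section Iwasawa

theorem coe_iwasawa (τ : ℍ) (φ : ℝ) :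
    (iwasawa τ φ).1 = !![√τ.im * Real.cos φ + τ.re * ((√τ.im)⁻¹ * Real.sin φ),
      √τ.im * -Real.sin φ + τ.re * ((√τ.im)⁻¹ * Real.cos φ);
      (√τ.im)⁻¹ * Real.sin φ, (√τ.im)⁻¹ * Real.cos φ] := by
  rw [iwasawa, mul_assoc]
  exact coe_unip_mul _ (coe_diagEl_mul _ rfl)

theorem iwasawa_I (φ : ℝ) : iwasawa UpperHalfPlane.I φ = rot φ := by
  apply Subtype.ext
  rw [coe_iwasawa]
  simp [rot]

theorem iwasawa_two_vadd (τ : ℍ) (φ : ℝ) :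
    iwasawa ((2 : ℝ) +ᵥ τ) φ = unip 2 * iwasawa τ φ := by
  apply Subtype.ext
  rw [coe_unip_mul _ (coe_iwasawa τ φ), coe_iwasawa, UpperHalfPlane.vadd_im,
    UpperHalfPlane.vadd_re]
  ring_nf

theorem re_negInv (τ : ℍ) : (negInv τ).re = -τ.re / ‖(τ : ℂ)‖ ^ 2 := by
  change (-1 / (τ : ℂ)).re = _
  simp [Complex.div_re, Complex.sq_norm]

theorem im_negInv (τ : ℍ) : (negInv τ).im = τ.im / ‖(τ : ℂ)‖ ^ 2 := by
  change (-1 / (τ : ℂ)).im = _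
  simp [Complex.sq_norm, neg_div]

theorem iwasawa_negInv (τ : ℍ) (φ : ℝ) :
    iwasawa (negInv τ) (φ + Complex.arg τ) = matS * iwasawa τ φ := by
  have h_norm_pos : 0 < ‖(τ : ℂ)‖ := norm_pos_iff.mpr τ.ne_zero
  have h_sqrt_pos : 0 < √τ.im := Real.sqrt_pos.mpr τ.im_pos
  have h_norm_sq : ‖(τ : ℂ)‖ ^ 2 = τ.re ^ 2 + (√τ.im ^ 2) ^ 2 := by
    rw [Real.sq_sqrt τ.im_pos.le, Complex.sq_norm, Complex.normSq_apply, sq, sq]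
    rfl
  have h_cos : Real.cos (Complex.arg τ) = τ.re / ‖(τ : ℂ)‖ := Complex.cos_arg τ.ne_zero
  have h_sin : Real.sin (Complex.arg τ) = √τ.im ^ 2 / ‖(τ : ℂ)‖ := by
    rw [Real.sq_sqrt τ.im_pos.le]
    exact Complex.sin_arg τ
  have h_sqrt : √(negInv τ).im = √τ.im / ‖(τ : ℂ)‖ := by
    rw [im_negInv, Real.sqrt_div τ.im_pos.le, Real.sqrt_sq h_norm_pos.le]
  apply Subtype.ext
  rw [coe_matS_mul (coe_iwasawa τ φ), coe_iwasawa, h_sqrt, re_negInv, Real.cos_add, Real.sin_add,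
    h_cos, h_sin]
  generalize √τ.im = w at *
  simp only [EmbeddingLike.apply_eq_iff_eq, Matrix.vecCons_inj, and_true, and_assoc]
  refine ⟨?_, ?_, ?_, ?_⟩ <;> field_simp
  · linear_combination Real.sin φ * h_norm_sq
  · linear_combination Real.cos φ * h_norm_sq
  · ring
  · ring

theorem sign_mul_of_pos {r : ℝ} (hr : 0 < r) (x : ℝ) : Real.sign (r * x) = Real.sign x := by
  rcases lt_trichotomy x 0 with hx | rfl | hx
  · rw [Real.sign_of_neg hx, Real.sign_of_neg (mul_neg_of_pos_of_neg hr hx)]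
  · rw [mul_zero]
  · rw [Real.sign_of_pos hx, Real.sign_of_pos (mul_pos hr hx)]

theorem cocycle_matS_iwasawa (m n : ℕ) (τ : ℍ) (φ : ℝ) :
    cocycle m n matS (iwasawa τ φ) =
      Complex.exp (-(Complex.I * π * (m * n : ℝ) *
        (Real.sign (Real.sin φ * Real.sin (φ + Complex.arg τ)) : ℝ) / 4)) := by
  have h_pos : 0 < (√τ.im)⁻¹ * (√(negInv τ).im)⁻¹ :=
    mul_pos (inv_pos.mpr (Real.sqrt_pos.mpr τ.im_pos))
      (inv_pos.mpr (Real.sqrt_pos.mpr (negInv τ).im_pos))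
  have h_entries : matS.1 1 0 * (iwasawa τ φ).1 1 0 * (matS * iwasawa τ φ).1 1 0 =
      (√τ.im)⁻¹ * (√(negInv τ).im)⁻¹ * (Real.sin φ * Real.sin (φ + Complex.arg τ)) := by
    rw [← iwasawa_negInv, coe_iwasawa, coe_iwasawa, mul_mul_mul_comm]
    simp [matS]
  rw [cocycle, h_entries, sign_mul_of_pos h_pos]

end Iwasawa

/-! ### Invariance under the theta group -/

section Invariance

variable {m n : ℕ}

/-- The element `(λ, μ; -μ ᵗλ)` of the Heisenberg group, for which the phase of the Schrödinger
representation reduces to `exp (2 π i tr(M x ᵗμ))`. -/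
def Heis.ofPair (p : VPair m n) : Heis m n :=
  ⟨p.1, p.2, -(p.2 * p.1ᵀ), by
    rw [neg_add_cancel]
    exact Matrix.isSymm_zero⟩

theorem isIntegral_ofPair (l u : ZMat m n) : (Heis.ofPair (toReal l, toReal u)).IsIntegral := by
  refine ⟨l, u, -(u * lᵀ), rfl, rfl, ?_⟩
  have h_neg : toReal (-(u * lᵀ)) = -toReal (u * lᵀ) := Matrix.map_neg _ Int.cast_neg _
  rw [h_neg, toReal_mul]
  rfl

theorem thetaV_eq_latticeSum {M : RMat m m} (hM : M.PosDef) (f : 𝓢(Fin m → Fin n → ℝ, ℂ))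
    (τ : ℍ) (φ : ℝ) (lam mu : RMat m n) :
    thetaV M f τ φ lam mu =
      latticeSum (jacobiRep M (Heis.ofPair (lam, mu)) (iwasawa τ φ) (onMat f)) := by
  rw [thetaV, ← tsum_mul_left]
  refine tsum_congr fun ω => ?_
  have h_phase : (M * (Heis.ofPair (lam, mu)).kap).trace + bil M lam mu +
      2 * bil M mu (toReal ω) = 2 * bil M (toReal ω) mu := by
    rw [Heis.ofPair, Matrix.mul_neg, Matrix.trace_neg, trace_mul_mul_transpose, neg_add_cancel,
      zero_add, bil_comm (isSymm_of_posDef hM)]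
  have h_iwasawa : iwasawa τ φ = unip τ.re * (diagEl τ.im τ.im_pos * rot φ) := mul_assoc _ _ _
  rw [iwasawa_I, ← expPi, expPi_add, jacobiRep, schrodinger_apply, h_iwasawa,
    weil_unip_mul hM (isSchwartz_onMat f), weil_diagEl_mul hM (isSchwartz_onMat f)]
  change _ = expPi (_ + bil M lam mu + 2 * bil M mu (toReal ω)) * _
  rw [h_phase]
  simp only [Heis.ofPair]
  ring

/-- The product `Θ_F ⋅ conj Θ_G` of theta sums at the point `h g` of the Jacobi group. -/
noncomputable def thetaPairing (M : RMat m m) (F G : RMat m n → ℂ) (h : Heis m n) (g : SL2R) : ℂ :=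
  latticeSum (jacobiRep M h g F) * (starRingEnd ℂ) (latticeSum (jacobiRep M h g G))

theorem mul_mul_conj_mul_of_norm_eq_one {c : ℂ} (hc : ‖c‖ = 1) (z w : ℂ) :
    c * z * (starRingEnd ℂ) (c * w) = z * (starRingEnd ℂ) w := by
  rw [map_mul, mul_mul_mul_comm, Complex.mul_conj', hc, Complex.ofReal_one, one_pow, one_mul]

theorem thetaPairing_congr (M : RMat m m) (F G : RMat m n → ℂ) {h k : Heis m n}
    (h_lam : h.lam = k.lam) (h_mu : h.mu = k.mu) (g : SL2R) :
    thetaPairing M F G h g = thetaPairing M F G k g := by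
  have h_phase (E : RMat m n → ℂ) : latticeSum (jacobiRep M h g E) =
      expPi ((M * h.kap).trace - (M * k.kap).trace) * latticeSum (jacobiRep M k g E) := by
    rw [← latticeSum_smul]
    congr 1
    ext x
    simp only [jacobiRep, Pi.smul_apply, smul_eq_mul, schrodinger_apply, h_lam, h_mu, ← mul_assoc,
      ← expPi_add]
    ring_nf
  rw [thetaPairing, h_phase F, h_phase G, mul_mul_conj_mul_of_norm_eq_one (norm_expPi _),
    thetaPairing]

/-- The function `Θ_F ⋅ conj Θ_G` on `SL(2, ℝ) ⋉ V(m, n)`. The element `(g, v)` has the left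
coordinates `(λ, μ) = v g⁻¹`. -/
noncomputable def thetaProd (M : RMat m m) (F G : RMat m n → ℂ) (x : GV m n) : ℂ :=
  thetaPairing M F G (Heis.ofPair (rAct x.vec x.sl⁻¹)) x.sl

theorem thetaProd_ofCoord {M : RMat m m} (hM : M.PosDef) (f g : 𝓢(Fin m → Fin n → ℝ, ℂ)) (τ : ℍ)
    (φ : ℝ) (lam mu : RMat m n) :
    thetaProd M (onMat f) (onMat g) (ofCoord τ φ lam mu) =
      thetaV M f τ φ lam mu * (starRingEnd ℂ) (thetaV M g τ φ lam mu) := by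
  have h_sl : (ofCoord τ φ lam mu).sl = iwasawa τ φ := one_mul _
  have h_vec : (ofCoord τ φ lam mu).vec = rAct (lam, mu) (iwasawa τ φ) := add_zero _
  rw [thetaProd, h_sl, h_vec, ← rAct_mul, mul_inv_cancel, rAct_one, thetaPairing,
    thetaV_eq_latticeSum hM, thetaV_eq_latticeSum hM]

theorem rAct_matS_inv (p : VPair m n) : rAct p matS⁻¹ = (-p.2, p.1) := by
  rw [rAct, Matrix.SpecialLinearGroup.coe_inv, matS, Matrix.adjugate_fin_two_of]
  simp

theorem rAct_unip_inv (u : ℝ) (p : VPair m n) : rAct p (unip u)⁻¹ = (p.1, p.2 - u • p.1) := by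
  rw [rAct, Matrix.SpecialLinearGroup.coe_inv, unip, Matrix.adjugate_fin_two_of]
  simp [sub_eq_neg_add]

theorem rAct_vec_mul (γ x : GV m n) :
    rAct (γ * x).vec (γ * x).sl⁻¹ = rAct (γ.vec + rAct x.vec x.sl⁻¹) γ.sl⁻¹ := by
  rw [GV.mul_def, mul_inv_rev, rAct_mul, rAct_add, ← rAct_mul, mul_inv_cancel, rAct_one]

variable {M : ZMat m m}

theorem thetaProd_matS_mul (hM : (toReal M).PosDef) (hM_unit : IsUnit M) {F G : RMat m n → ℂ}
    (hF : IsSchwartz F) (hG : IsSchwartz G) (x : GV m n) :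
    thetaProd (toReal M) F G (⟨matS, 0⟩ * x) = thetaProd (toReal M) F G x := by
  set h := Heis.ofPair (rAct x.vec x.sl⁻¹)
  calc thetaProd (toReal M) F G (⟨matS, 0⟩ * x)
      = thetaPairing (toReal M) F G h.inversion (matS * x.sl) := by
        refine thetaPairing_congr _ _ _ ?_ ?_ _
        all_goals
          rw [rAct_vec_mul, rAct_matS_inv, zero_add]
          rfl
    _ = thetaPairing (toReal M) F G h x.sl := by
        rw [thetaPairing, latticeSum_jacobiRep_matS_mul hM hM_unit hF,
          latticeSum_jacobiRep_matS_mul hM hM_unit hG,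
          mul_mul_conj_mul_of_norm_eq_one (norm_cocycle _ _), thetaPairing]

theorem thetaProd_unip_two_mul (hM : (toReal M).PosDef) {F G : RMat m n → ℂ}
    (hF : IsSchwartz F) (hG : IsSchwartz G) (s : ZMat m n) (x : GV m n) :
    thetaProd (toReal M) F G (⟨unip 2, (0, toReal s)⟩ * x) = thetaProd (toReal M) F G x := by
  set h := Heis.ofPair (rAct x.vec x.sl⁻¹)
  calc thetaProd (toReal M) F G (⟨unip 2, (0, toReal s)⟩ * x)
      = thetaPairing (toReal M) F G (h.shift (toReal s)) (unip 2 * x.sl) := by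
        refine thetaPairing_congr _ _ _ ?_ ?_ _
        all_goals rw [rAct_vec_mul, rAct_unip_inv]
        · exact zero_add _
        · simp [h, Heis.ofPair, Heis.shift, sub_add_eq_add_sub, add_sub_assoc]
    _ = thetaPairing (toReal M) F G h x.sl := by
        rw [thetaPairing, latticeSum_jacobiRep_unip_two_mul hM hF,
          latticeSum_jacobiRep_unip_two_mul hM hG, thetaPairing]

theorem thetaProd_translation_mul (hM : (toReal M).IsSymm) (F G : RMat m n → ℂ) (l u : ZMat m n)
    (x : GV m n) :
    thetaProd (toReal M) F G (⟨1, (toReal l, toReal u)⟩ * x) = thetaProd (toReal M) F G x := by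
  set h := Heis.ofPair (rAct x.vec x.sl⁻¹)
  calc thetaProd (toReal M) F G (⟨1, (toReal l, toReal u)⟩ * x)
      = thetaPairing (toReal M) F G (Heis.ofPair (toReal l, toReal u) * h) (1 * x.sl) := by
        refine thetaPairing_congr _ _ _ ?_ ?_ _
        all_goals
          rw [rAct_vec_mul, inv_one, rAct_one]
          rfl
    _ = thetaPairing (toReal M) F G h x.sl := by
        rw [one_mul, thetaPairing, latticeSum_jacobiRep_mul hM (isIntegral_ofPair l u),
          latticeSum_jacobiRep_mul hM (isIntegral_ofPair l u),
          mul_mul_conj_mul_of_norm_eq_one (norm_expPi _), thetaPairing]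

theorem eq_mul_left_of_mem_closure {G X : Type*} [Group G] {S : Set G} {Φ : G → X}
    (hΦ : ∀ γ ∈ S, ∀ x, Φ (γ * x) = Φ x) {γ : G} (hγ : γ ∈ Subgroup.closure S) (x : G) :
    Φ (γ * x) = Φ x := by
  induction hγ using Subgroup.closure_induction generalizing x with
  | mem γ hγ => exact hΦ γ hγ x
  | one => rw [one_mul]
  | mul γ δ _ _ ihγ ihδ => rw [mul_assoc, ihγ, ihδ]
  | inv γ _ ih => rw [← ih (γ⁻¹ * x), mul_inv_cancel_left]

theorem thetaProd_mul_of_mem_Gamma2 (hM : (toReal M).PosDef) (hM_unit : IsUnit M)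
    {F G : RMat m n → ℂ} (hF : IsSchwartz F) (hG : IsSchwartz G) {γ : GV m n}
    (hγ : γ ∈ Gamma2 m n) (x : GV m n) :
    thetaProd (toReal M) F G (γ * x) = thetaProd (toReal M) F G x := by
  refine eq_mul_left_of_mem_closure ?_ hγ x
  rintro _ ((rfl | ⟨s, rfl⟩) | ⟨l, u, rfl⟩) x
  · exact thetaProd_matS_mul hM hM_unit hF hG x
  · exact thetaProd_unip_two_mul hM hF hG s x
  · exact thetaProd_translation_mul (isSymm_of_posDef hM) F G l u x

end Invariance

end JacobiTheta

theorem theorem12p1 (m n : ℕ) (hm : 0 < m) (hn : 0 < n)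
    (M : ZMat m m) (hM : (toReal M).PosDef) :
    -- the theta series converge absolutely
    (∀ (f : 𝓢(Fin m → Fin n → ℝ, ℂ)) (τ : ℍ) (φ : ℝ) (h : Heis m n),
      Summable (thetaTerm (toReal M) f τ φ h)) ∧
    -- Jacobi 1, with the explicit value of the cocycle
    (Set.range (fun ω : ZMat m n => M * ω) = Set.univ →
      ∀ (f : 𝓢(Fin m → Fin n → ℝ, ℂ)) (τ : ℍ) (φ : ℝ) (h : Heis m n),
        theta (toReal M) f (negInv τ) (φ + Complex.arg τ)
            ⟨-h.mu, h.lam, h.kap, h.isSymm_inversion⟩ =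
          (((toReal M).det ^ (-(n : ℝ) / 2) : ℝ) : ℂ) * cocycle m n matS (iwasawa τ φ) *
            theta (toReal M) f τ φ h ∧
        cocycle m n matS (iwasawa τ φ) =
          Complex.exp (-(Complex.I * Real.pi * (m * n : ℝ) *
            (Real.sign (Real.sin φ * Real.sin (φ + Complex.arg τ)) : ℝ) / 4))) ∧
    -- Jacobi 2
    (∀ (f : 𝓢(Fin m → Fin n → ℝ, ℂ)) (s : ZMat m n) (τ : ℍ) (φ : ℝ) (h : Heis m n),
      theta (toReal M) f ((2 : ℝ) +ᵥ τ) φ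
          ⟨h.lam, toReal s - (2 : ℝ) • h.lam + h.mu, h.kap - toReal s * h.lamᵀ,
            h.isSymm_shift (toReal s)⟩ =
        theta (toReal M) f τ φ h) ∧
    -- Jacobi 3
    (∀ (f : 𝓢(Fin m → Fin n → ℝ, ℂ)) (h₀ : Heis m n), h₀.IsIntegral →
      ∀ (τ : ℍ) (φ : ℝ) (h : Heis m n),
        theta (toReal M) f τ φ (h₀ * h) =
          Complex.exp (Real.pi * Complex.I *
            ((toReal M * (h₀.kap + h₀.mu * h₀.lamᵀ)).trace : ℝ)) *
            theta (toReal M) f τ φ h) ∧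
    -- invariance of the product under left multiplication by the theta group
    (Set.range (fun ω : ZMat m n => M * ω) = Set.univ →
      ∀ (f g : 𝓢(Fin m → Fin n → ℝ, ℂ)), ∀ γ ∈ Gamma2 m n,
        ∀ (τ τ' : ℍ) (φ φ' : ℝ) (lam mu lam' mu' : RMat m n),
          ofCoord τ' φ' lam' mu' = γ * ofCoord τ φ lam mu →
          thetaV (toReal M) f τ' φ' lam' mu' *
              (starRingEnd ℂ) (thetaV (toReal M) g τ' φ' lam' mu') =
            thetaV (toReal M) f τ φ lam mu *
              (starRingEnd ℂ) (thetaV (toReal M) g τ φ lam mu)) := by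
  have hM_symm : (toReal M).IsSymm := isSymm_of_posDef hM
  refine ⟨fun f τ φ h => ((isSchwartz_onMat f).jacobiRep hM h _).summable_toReal,
    fun h_range f τ φ h => ⟨?_, cocycle_matS_iwasawa m n τ φ⟩, fun f s τ φ h => ?_,
    fun f h₀ h₀_int τ φ h => latticeSum_jacobiRep_mul hM_symm h₀_int h _ _,
    fun h_range f g γ hγ τ τ' φ φ' lam mu lam' mu' h_eq => ?_⟩
  · have hM_unit : IsUnit M := isUnit_of_range_mul_eq_univ hn h_range
    have h_det : (((toReal M).det ^ (-(n : ℝ) / 2) : ℝ) : ℂ) = 1 := by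
      rw [det_toReal_eq_one hM hM_unit, Real.one_rpow, Complex.ofReal_one]
    have h_inversion := latticeSum_jacobiRep_matS_mul hM hM_unit (isSchwartz_onMat f) h
      (iwasawa τ φ)
    rw [← iwasawa_negInv] at h_inversion
    rwa [h_det, one_mul]
  · have h_shift := latticeSum_jacobiRep_unip_two_mul hM (isSchwartz_onMat f) h s (iwasawa τ φ)
    rwa [← iwasawa_two_vadd] at h_shift
  · have hM_unit : IsUnit M := isUnit_of_range_mul_eq_univ hn h_range
    rw [← thetaProd_ofCoord hM, ← thetaProd_ofCoord hM, h_eq]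
    exact thetaProd_mul_of_mem_Gamma2 hM hM_unit (isSchwartz_onMat f) (isSchwartz_onMat g) hγ _
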